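/- A \emph{site} is a closed ball $S=(C,r)$ in $\mathbb R^3$ with $r\ge 0$, and $\delta(p,S)=\|p-C\|-r$. Let $S_i,S_j,S_k,S_\alpha$ be sites, none contained in another, such that the trisector $\tau_{ijk}=\{p:\delta(p,S_i)=\delta(p,S_j)=\delta(p,S_k)\}$ is hyperbolic, i.e. a branch of a hyperbola or a straight line. Orient $\tau_{ijk}$ by the right-hand rule for $C_i,C_j,C_k$, let $o$ be the point where it meets the plane of these centers, and for $p\in\tau_{ijk}$ put $\zeta(p)=\delta(p,S_i)-\delta(o,S_i)$ if $o\prec p$ and $\zeta(p)=-(\delta(p,S_i)-\delta(o,S_i))$ otherwise. Let $\mathcal T(p)$ be the sphere centered at $p$ of (signed) radius $\delta(p,S_i)$, and $\delta(x,\mathcal T(p))=\|x-p\|-\delta(p,S_i)$. The shadow region of $S_\alpha$ is $SR(S_\alpha)=\{p\in\tau_{ijk}:\delta(C_\alpha,\mathcal T(p))<r_\alpha\}$. Let $E$ (the Existence predicate) be the number of Apollonius vertices, i.e. of points equidistant from the four sites. Such a vertex is called $v_{ijk\alpha}$, resp. $v_{ikj\alpha}$, if the tetrahedron $T_iT_jT_kT_\alpha$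 of the tangency points of its Apollonius sphere is positively, resp. negatively, oriented, where the orientation of $KLMN$ is the sign of the $4\times4$ determinant with rows $(K,1),(L,1),(M,1),(N,1)$. (If the common distance is not positive, the tangency points are taken after subtracting a common constant from all radii, which makes that distance positive and does not change the equidistant points.) Let $\Pi^{\mp}$ be the two planes tangent to $S_i,S_j,S_k$ with these sites on their positive side, $\Pi^-$ and $\Pi^+$ being the limits of $\mathcal T(p)$ as $\zeta(p)\to-\infty$ and $\zeta(p)\to+\infty$, and let $(\sigma_1,\sigma_2)=(\operatorname{sgn}\delta(S_\alpha,\Pi^-),\operatorname{sgn}\delta(S_\alpha,\Pi^+))$ (the Distance predicate), where $\delta(S,\Pi)$ is the signed distance of the center of $S$ from $\Pi$ minus its radius. Assume that the input is non-degenerate: no tetrahedron $T_iT_jT_kT_\alpha$ is flat, and $\sigma_1,\sigma_2\neq0$. Then $o,\zeta,\Pi^-,\Pi^+$ are well defined for every hyperbolic triple of sites, none contained in another: the trisector meets the plane of the centers exactly in $o$, $\zeta$ is a bijection from $\tau_{ijk}$ onto $\mathbb R$, and there are exactly two such tangent planes, $\Pi^-\ne\Pi^+$, which are these limits. Moreover: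 (1) $\zeta(SR(S_\alpha))$ has exactly one of the six types $\emptyset$, $\mathbb R$, $(-\infty,\phi)$, $(\chi,\infty)$, $(\chi,\phi)$ with $\chi<\phi$, $(-\infty,\phi)\cup(\chi,\infty)$ with $\phi<\chi$, where $\phi,\chi\in\mathbb R$. (2) The type is determined by the Existence and Distance predicates, for which only the following outcomes $(E;\sigma_1,\sigma_2)$ occur: $(0;+,+)$ gives $\emptyset$; $(0;-,-)$ gives $\mathbb R$; $(1;-,+)$ gives $(-\infty,\phi)$; $(1;+,-)$ gives $(\chi,\infty)$; $(2;+,+)$ gives $(\chi,\phi)$; $(2;-,-)$ gives $(-\infty,\phi)\cup(\chi,\infty)$. (3) If $\phi$ occurs in the type, there is exactly one vertex $v_{ijk\alpha}$ and $\phi=\zeta(v_{ijk\alpha})$; if $\chi$ occurs, there is exactly one vertex $v_{ikj\alpha}$ and $\chi=\zeta(v_{ikj\alpha})$. In the types $(-\infty,\phi)$ and $(\chi,\infty)$ there is no vertex of the other kind. (4) The type can be evaluated by determining signs of quantities of algebraic degree at most $8$: there are finitely many polynomials with integer coefficients and total degree at most $8$ in the sixteen input quantities (the center coordinates and the radii of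 the four sites), the same ones for all inputs, such that the type is a function of their signs. -/

import Mathlib

namespace Apollonius

/-- Euclidean three-space. -/
abbrev E3 : Type := EuclideanSpace ℝ (Fin 3)

/-- A site: a closed ball of Euclidean space, given by its center and its radius. -/
structure Site where
  center : E3
  radius : ℝ
  radius_nonneg : 0 ≤ radius

/-- The (signed) distance `δ(p, S) = ‖p - C‖ - r` of a point from a site. -/
noncomputable def Site.delta (S : Site) (p : E3) : ℝ := dist p S.center - S.radius

/-- `S` is contained in `T`, as closed balls. -/
def Site.ContainedIn (S T : Site) : Prop :=
  Metric.closedBall S.center S.radius ⊆ Metric.closedBall T.center T.radius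

/-- The trisector: the locus of the points equidistant from the three sites. -/
def trisector (Si Sj Sk : Site) : Set E3 :=
  {p | Si.delta p = Sj.delta p ∧ Si.delta p = Sk.delta p}

/-- A set of points is a straight line. -/
def IsStraightLine (T : Set E3) : Prop :=
  ∃ c e : E3, e ≠ 0 ∧ T = Set.range fun t : ℝ => c + t • e

/-- A set of points is one branch of a hyperbola. -/
def IsHyperbolaBranch (T : Set E3) : Prop :=
  ∃ (c e₁ e₂ : E3) (a b : ℝ), 0 < a ∧ 0 < b ∧ ‖e₁‖ = 1 ∧ ‖e₂‖ = 1 ∧ inner ℝ e₁ e₂ = 0 ∧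
    T = Set.range fun t : ℝ => c + (a * Real.cosh t) • e₁ + (b * Real.sinh t) • e₂

/-- Three sites, none inside another, whose trisector is hyperbolic:
a branch of a hyperbola or a straight line. -/
structure HyperbolicTriple (Si Sj Sk : Site) : Prop where
  not_contained : ∀ m n : Fin 3, m ≠ n → ¬ (![Si, Sj, Sk] m).ContainedIn (![Si, Sj, Sk] n)
  hyperbolic : IsHyperbolaBranch (trisector Si Sj Sk) ∨ IsStraightLine (trisector Si Sj Sk)

/-- The determinant whose sign is the orientation of the tetrahedron `KLMN`. It is positive iff the
thumb of a right hand curled along `L, M, N` points towards `K`. -/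
noncomputable def orientDet (K L M N : E3) : ℝ :=
  Matrix.det !![K 0, K 1, K 2, 1; L 0, L 1, L 2, 1; M 0, M 1, M 2, 1; N 0, N 1, N 2, 1]

/-! ### The oriented trisector and its parametrization -/

/-- The intersection point `o` of the trisector with the plane of the three centers. -/
noncomputable def trisectorOrigin (Si Sj Sk : Site) : E3 :=
  Classical.epsilon fun o : E3 =>
    o ∈ trisector Si Sj Sk ∩ (affineSpan ℝ {Si.center, Sj.center, Sk.center} : Set E3)

open Classical in
/-- The parametrization `ζ` of the trisector, oriented by the right-hand rule for `Ci, Cj, Ck`: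
`ζ(p) = δ(p, Si) - δ(o, Si)` if `o ≺ p`, and `ζ(p) = -(δ(p, Si) - δ(o, Si))` otherwise. -/
noncomputable def zeta (Si Sj Sk : Site) (p : E3) : ℝ :=
  if 0 < orientDet p Si.center Sj.center Sk.center then
    Si.delta p - Si.delta (trisectorOrigin Si Sj Sk)
  else -(Si.delta p - Si.delta (trisectorOrigin Si Sj Sk))

/-- The distance `δ(x, 𝒯(p))` of a point `x` from the sphere `𝒯(p)` centered at a point `p` of the
trisector and externally tangent to the three sites; its radius is `δ(p, Si)`. -/
noncomputable def deltaTangentSphere (Si : Site) (p x : E3) : ℝ := dist x p - Si.delta p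

/-- The shadow region of `Sa` on the trisector of `Si, Sj, Sk`. -/
def shadowRegion (Si Sj Sk Sa : Site) : Set E3 :=
  {p | p ∈ trisector Si Sj Sk ∧ deltaTangentSphere Si p Sa.center < Sa.radius}

/-! ### The Existence predicate and the two kinds of Apollonius vertices -/

/-- The Apollonius vertices of four sites: the points equidistant from all of them, that is, the
centers of the (finite) Apollonius spheres. -/
def apolloniusVertices (Si Sj Sk Sa : Site) : Set E3 :=
  {v | Si.delta v = Sj.delta v ∧ Si.delta v = Sk.delta v ∧ Si.delta v = Sa.delta v}

/-- The Existence predicate: the number of Apollonius spheres not centered at infinity. -/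
noncomputable def existencePred (Si Sj Sk Sa : Site) : ℕ∞ :=
  (apolloniusVertices Si Sj Sk Sa).encard

/-- The point at distance `ρ` from `v` in the direction of the center of `S`. -/
noncomputable def contactPoint (ρ : ℝ) (v : E3) (S : Site) : E3 :=
  v + (ρ / dist v S.center) • (S.center - v)

/-- The orientation determinant of the tetrahedron of the tangency points `Ti Tj Tk Ta` of an
Apollonius sphere centered at `v`, scaled from `v` to an Apollonius sphere of radius `1`. See
`orientDet_contactPoint`: for a sphere of positive radius `ρ` this only divides the determinant by
`ρ ^ 3`. (Equivalently, a common constant has been added to all radii, which leaves all the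
equidistant points unchanged; so a common distance `≤ 0` is covered as well.) -/
noncomputable def tangencyDet (Si Sj Sk Sa : Site) (v : E3) : ℝ :=
  orientDet (contactPoint 1 v Si) (contactPoint 1 v Sj) (contactPoint 1 v Sk) (contactPoint 1 v Sa)

theorem orientDet_contactPoint (Si Sj Sk Sa : Site) (v : E3) (ρ : ℝ) :
    orientDet (contactPoint ρ v Si) (contactPoint ρ v Sj) (contactPoint ρ v Sk)
      (contactPoint ρ v Sa) = ρ ^ 3 * tangencyDet Si Sj Sk Sa v := by
  simp [tangencyDet, orientDet, contactPoint, Matrix.det_succ_row_zero, Fin.sum_univ_succ,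
    Fin.succAbove]
  ring

/-- For an Apollonius sphere of radius `ρ = δ(v, S)` the contact point is the tangency point: it is
at distance `ρ` from `v`, and it lies on the boundary of the site. -/
theorem contactPoint_mem (S : Site) (v : E3) (h : 0 < S.delta v) :
    dist (contactPoint (S.delta v) v S) v = S.delta v ∧
      dist (contactPoint (S.delta v) v S) S.center = S.radius := by
  have hr := S.radius_nonneg
  have hd : 0 < dist v S.center := by unfold Site.delta at h; linarith
  have hn : ‖S.center - v‖ = dist v S.center := by rw [dist_comm, dist_eq_norm]
  have h1 : contactPoint (S.delta v) v S - v =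
      (S.delta v / dist v S.center) • (S.center - v) := by
    simp [contactPoint]
  have h2 : contactPoint (S.delta v) v S - S.center =
      (-(S.radius / dist v S.center)) • (S.center - v) := by
    have h3 : S.delta v / dist v S.center = 1 - S.radius / dist v S.center := by
      unfold Site.delta
      field_simp
    rw [contactPoint, h3]
    module
  constructor
  · rw [dist_eq_norm, h1, norm_smul, hn, Real.norm_eq_abs, abs_of_pos (by positivity)]
    field_simp
  · rw [dist_eq_norm, h2, norm_smul, hn, norm_neg, Real.norm_eq_abs,
      abs_of_nonneg (by positivity)]
    field_simp

/-- The vertices `v_ijka`: the tetrahedron of the tangency points is positively oriented. -/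
def verticesPos (Si Sj Sk Sa : Site) : Set E3 :=
  {v | v ∈ apolloniusVertices Si Sj Sk Sa ∧ 0 < tangencyDet Si Sj Sk Sa v}

/-- The vertices `v_ikja`: the tetrahedron of the tangency points is negatively oriented. -/
def verticesNeg (Si Sj Sk Sa : Site) : Set E3 :=
  {v | v ∈ apolloniusVertices Si Sj Sk Sa ∧ tangencyDet Si Sj Sk Sa v < 0}

/-! ### Commonly tangent planes and the Distance predicate -/

/-- An oriented plane `{x | ⟪ν, x⟫ + d = 0}` with unit normal `ν`, which points to its positive
side. -/
@[ext] structure OrientedPlane where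
  normal : E3
  offset : ℝ
  norm_normal : ‖normal‖ = 1

/-- The signed distance of a point from an oriented plane. -/
noncomputable def OrientedPlane.signedDist (Q : OrientedPlane) (x : E3) : ℝ :=
  inner ℝ Q.normal x + Q.offset

/-- The signed distance `δ(S, Π) = δ(C, Π) - r` of a site from an oriented plane. -/
noncomputable def OrientedPlane.siteDist (Q : OrientedPlane) (S : Site) : ℝ :=
  Q.signedDist S.center - S.radius

/-- The planes tangent to the three sites that leave all of them on their positive side. -/
def commonTangentPlanes (Si Sj Sk : Site) : Set OrientedPlane :=
  {Q | Q.siteDist Si = 0 ∧ Q.siteDist Sj = 0 ∧ Q.siteDist Sk = 0}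

/-- `Q` is a commonly tangent plane and the limit of the spheres `𝒯(p)`, as `ζ(p)` tends along `l`
on the trisector. -/
def IsPlaneAtInfinity (Si Sj Sk : Site) (l : Filter ℝ) (Q : OrientedPlane) : Prop :=
  Q ∈ commonTangentPlanes Si Sj Sk ∧
  ∀ x : E3, Filter.Tendsto (fun p => deltaTangentSphere Si p x)
    (Filter.comap (zeta Si Sj Sk) l ⊓ Filter.principal (trisector Si Sj Sk))
    (nhds (Q.signedDist x))

instance : Nonempty OrientedPlane :=
  ⟨⟨EuclideanSpace.single 0 1, 0, by simp⟩⟩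

/-- The plane `Π⁻`, the Apollonius sphere at infinity for `ζ(p) → -∞`. -/
noncomputable def planeMinus (Si Sj Sk : Site) : OrientedPlane :=
  Classical.epsilon (IsPlaneAtInfinity Si Sj Sk Filter.atBot)

/-- The plane `Π⁺`, the Apollonius sphere at infinity for `ζ(p) → +∞`. -/
noncomputable def planePlus (Si Sj Sk : Site) : OrientedPlane :=
  Classical.epsilon (IsPlaneAtInfinity Si Sj Sk Filter.atTop)

/-- The Distance predicate `(sgn δ(Sa, Π⁻), sgn δ(Sa, Π⁺))`. -/
noncomputable def distancePred (Si Sj Sk Sa : Site) : SignType × SignType :=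
  (SignType.sign ((planeMinus Si Sj Sk).siteDist Sa),
    SignType.sign ((planePlus Si Sj Sk).siteDist Sa))

/-! ### The Shadow predicate -/

/-- The six topological types of a shadow region. -/
inductive ShadowType where
  /-- `∅` -/
  | empty
  /-- `ℝ` -/
  | full
  /-- `(-∞, φ)` -/
  | left
  /-- `(χ, ∞)` -/
  | right
  /-- `(χ, φ)` -/
  | middle
  /-- `(-∞, φ) ∪ (χ, ∞)` -/
  | outer

/-- A set of reals is of the given type. -/
def HasShadowType (A : Set ℝ) : ShadowType → Prop
  | .empty => A = ∅
  | .full => A = Set.univ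
  | .left => ∃ φ, A = Set.Iio φ
  | .right => ∃ χ, A = Set.Ioi χ
  | .middle => ∃ χ φ, χ < φ ∧ A = Set.Ioo χ φ
  | .outer => ∃ φ χ, φ < χ ∧ A = Set.Iio φ ∪ Set.Ioi χ

/-- The image `ζ(SR(Sa))` in `ℝ` whose type is the outcome of the Shadow predicate. -/
def shadowImage (Si Sj Sk Sa : Site) : Set ℝ :=
  zeta Si Sj Sk '' shadowRegion Si Sj Sk Sa

/-- The table that yields the type from the outcome `E` of the Existence predicate and the outcome
`(σ₁, σ₂)` of the Distance predicate. -/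
inductive ShadowTable : ℕ∞ → SignType × SignType → ShadowType → Prop
  | empty : ShadowTable 0 (1, 1) .empty
  | full : ShadowTable 0 (-1, -1) .full
  | right : ShadowTable 1 (1, -1) .right
  | left : ShadowTable 1 (-1, 1) .left
  | middle : ShadowTable 2 (1, 1) .middle
  | outer : ShadowTable 2 (-1, -1) .outer

/-- A non-degenerate input of the Shadow predicate. The last two conditions say that the Existence
predicate meets no flat tangency tetrahedron (`v_ijka` and `v_ikja` do not coincide) and that
the Distance predicate returns no `0` (no Apollonius sphere at infinity). -/
structure ShadowInput (Si Sj Sk Sa : Site) : Prop where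
  triple : HyperbolicTriple Si Sj Sk
  not_contained : ∀ m n : Fin 4, m ≠ n →
    ¬ (![Si, Sj, Sk, Sa] m).ContainedIn (![Si, Sj, Sk, Sa] n)
  not_flat : ∀ v ∈ apolloniusVertices Si Sj Sk Sa, tangencyDet Si Sj Sk Sa v ≠ 0
  distance_ne : (distancePred Si Sj Sk Sa).1 ≠ 0 ∧ (distancePred Si Sj Sk Sa).2 ≠ 0

/-- The sixteen input quantities: `(n, 0), (n, 1), (n, 2)` are the coordinates of the center of the
`n`-th site, and `(n, 3)` is its radius. -/
def inputQuantities (Si Sj Sk Sa : Site) (q : Fin 4 × Fin 4) : ℝ :=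
  let S : Site := ![Si, Sj, Sk, Sa] q.1
  ![S.center 0, S.center 1, S.center 2, S.radius] q.2

end Apollonius

/-!
Regard a site as the point (center, radius) of Minkowski space, seen from `Si`, and let `(x, -t)`
stand for a point `p = Ci + x` at distance `t = ‖x‖` from `Ci`. Being equidistant from `Si` and `S`
is then the single linear equation `excess Si S p = 0` in the null vector `(x, -t)`, because no site
contains another, and `p` is in the shadow of `S` iff `excess Si S p > 0`. Hence the trisector is
the intersection of the null cone with a plane.

A hyperbolic trisector has two ends with different directions. This forces the centers to be
non-collinear and gives the two unit vectors `wp` and `wm`, mirror images in the plane of the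
centers, for which `(w, -1)` is Lorentz orthogonal to `Sj - Si` and `Sk - Si`
(`HyperbolicTriple.nonempty_frame`). All points of the trisector are
`Ci + hub + (scale / 2) (e^θ wp + e^(-θ) wm)` (`TrisectorFrame.point_mem`,
`TrisectorFrame.exists_point_eq`), and `ζ` is a strictly increasing bijective function of `θ`
(`TrisectorFrame.zetaIso`). The common tangent planes are those with the normals `-wm` and `-wp`,
which are the limits of the tangent spheres at the two ends.

Along the trisector, `excess Si Sa` becomes `A z + B + C z⁻¹` with `z = e^θ`
(`TrisectorFrame.excess_point`). The Distance predicate is the pair of the signs of `-C` and `-A`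
(`TrisectorFrame.distancePred_eq`), the Apollonius vertices are the zeros, and the orientation of
the tangency tetrahedron at a zero is opposite to the sign of the derivative
(`TrisectorFrame.sign_tangencyDet_point`), so that the shadow region ends at a positive vertex and
begins at a negative one. What remains is the discussion of a quadratic polynomial on the positive
half-line without double zeros (`shadowProfile_expSum`): its type is determined by the signs of
`A`, `C`, `B` and `B ^ 2 - 4 A C`.

For the algebraic degree, the signs of `A` and `C` are those of the sum, the difference and the
product: up to positive factors these are polynomials of degree `5`, `3` and `6`, the product being
minus the Lorentzian Gram determinant of the sites. The sign of `B` is that of a polynomial of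
degree `6`. The discriminant naturally is a polynomial of degree `12`; by Sylvester's identity it
is the product of the Gram determinant of `Sj - Si` and `Sk - Si`, which is positive, and of a
bordered Gram determinant of degree `8` (`TrisectorFrame.discrim_eq`).
-/

namespace Apollonius

open Filter Topology

/-! ### The cross product and the Lorentzian product of sites -/

theorem inner_coord (x y : E3) : inner ℝ x y = x 0 * y 0 + x 1 * y 1 + x 2 * y 2 := by
  simp [PiLp.inner_apply, Fin.sum_univ_three]
  ring

theorem ext_coord {x y : E3} (h0 : x 0 = y 0) (h1 : x 1 = y 1) (h2 : x 2 = y 2) : x = y := by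
  ext i
  fin_cases i <;> assumption

/-- The cross product on `E3`. -/
noncomputable def cross (u v : E3) : E3 :=
  !₂[u 1 * v 2 - u 2 * v 1, u 2 * v 0 - u 0 * v 2, u 0 * v 1 - u 1 * v 0]

theorem cross_zero (u v : E3) : cross u v 0 = u 1 * v 2 - u 2 * v 1 := by simp [cross]

theorem cross_one (u v : E3) : cross u v 1 = u 2 * v 0 - u 0 * v 2 := by simp [cross]

theorem cross_two (u v : E3) : cross u v 2 = u 0 * v 1 - u 1 * v 0 := by simp [cross]

theorem inner_cross_self (u v : E3) :
    inner ℝ (cross u v) (cross u v) =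
      inner ℝ u u * inner ℝ v v - inner ℝ u v ^ 2 := by
  simp only [inner_coord, cross_zero, cross_one, cross_two]
  ring

theorem inner_left_cross (u v : E3) : inner ℝ u (cross u v) = 0 := by
  simp only [inner_coord, cross_zero, cross_one, cross_two]
  ring

theorem inner_right_cross (u v : E3) : inner ℝ v (cross u v) = 0 := by
  simp only [inner_coord, cross_zero, cross_one, cross_two]
  ring

/-- Decomposition of a vector along `u`, `v` and their cross product. -/
theorem cross_decomposition (u v x : E3) :
    inner ℝ (cross u v) (cross u v) • x =
      (inner ℝ x u * inner ℝ v v - inner ℝ x v * inner ℝ u v) • u +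
      (inner ℝ x v * inner ℝ u u - inner ℝ x u * inner ℝ u v) • v +
      inner ℝ x (cross u v) • cross u v := by
  apply ext_coord <;>
  · simp only [inner_coord, cross_zero, cross_one, cross_two, PiLp.add_apply, PiLp.smul_apply,
      smul_eq_mul]
    ring

theorem orientDet_eq_inner_cross (p x y z : E3) :
    orientDet p x y z = inner ℝ (p - x) (cross (y - x) (z - x)) := by
  simp only [inner_coord, cross_zero, cross_one, cross_two, PiLp.sub_apply]
  simp [orientDet, Matrix.det_succ_row_zero, Fin.sum_univ_succ, Fin.succAbove]
  ring

/-- The center of `T` relative to the center of `S`. -/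
noncomputable def disp (S T : Site) : E3 := T.center - S.center

/-- The radius of `T` relative to the radius of `S`. -/
noncomputable def gap (S T : Site) : ℝ := T.radius - S.radius

/-- The Lorentzian product of the differences `T - S` and `U - S`, where a site is regarded as the
point (center, radius) of Minkowski space. -/
noncomputable def gram (S T U : Site) : ℝ :=
  inner ℝ (disp S T) (disp S U) - gap S T * gap S U

theorem gram_comm (S T U : Site) : gram S T U = gram S U T := by
  simp only [gram, real_inner_comm (disp S T)]
  ring

theorem abs_gap_lt {S T : Site} (h : ¬ S.ContainedIn T) (h' : ¬ T.ContainedIn S) :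
    |gap S T| < ‖disp S T‖ := by
  have e : ‖disp S T‖ = dist T.center S.center := by rw [disp, dist_eq_norm]
  rw [e, abs_lt, gap]
  constructor
  · by_contra hc
    exact h' (Metric.closedBall_subset_closedBall' (by linarith))
  · by_contra hc
    refine h (Metric.closedBall_subset_closedBall' ?_)
    rw [dist_comm]
    linarith

theorem gram_self_pos {S T : Site} (h : |gap S T| < ‖disp S T‖) : 0 < gram S T T := by
  rw [gram, real_inner_self_eq_norm_sq, ← pow_two, sub_pos, ← sq_abs]
  gcongr

theorem abs_gap_lt_of_gram_pos {S T : Site} (h : 0 < gram S T T) : |gap S T| < ‖disp S T‖ := by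
  rw [gram, real_inner_self_eq_norm_sq, ← pow_two, sub_pos] at h
  exact abs_lt_of_sq_lt_sq h (norm_nonneg _)

/-- A quantity of the sign of `δ(p, S) - δ(p, T)` that is affine in `p` and its distance from
the center of `S`, provided that neither site contains the other. -/
noncomputable def excess (S T : Site) (p : E3) : ℝ :=
  inner ℝ (p - S.center) (disp S T) + gap S T * dist p S.center - gram S T T / 2

theorem excess_eq {S T : Site} (h : 0 < gram S T T) (p : E3) :
    ∃ k : ℝ, 0 < k ∧ (S.delta p - T.delta p) * k = 2 * excess S T p := by
  have hg := abs_gap_lt_of_gram_pos h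
  have e : p - T.center = (p - S.center) - disp S T := by rw [disp]; abel
  have tri : ‖disp S T‖ ≤ ‖p - S.center‖ + ‖p - T.center‖ := by
    have : disp S T = (p - S.center) - (p - T.center) := by rw [disp]; abel
    rw [this]
    exact norm_sub_le _ _
  have sq : ‖p - T.center‖ ^ 2 = ‖p - S.center‖ ^ 2 - 2 * inner ℝ (p - S.center) (disp S T) +
      ‖disp S T‖ ^ 2 := by
    rw [e, norm_sub_sq_real]
  refine ⟨‖p - T.center‖ + ‖p - S.center‖ + gap S T, ?_, ?_⟩
  · have := neg_abs_le (gap S T)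
    linarith
  · simp only [excess, Site.delta, gram, real_inner_self_eq_norm_sq, dist_eq_norm]
    have : gap S T = T.radius - S.radius := rfl
    rw [this] at *
    linear_combination -sq

theorem delta_eq_iff {S T : Site} (h : 0 < gram S T T) (p : E3) :
    S.delta p = T.delta p ↔ excess S T p = 0 := by
  obtain ⟨k, hk, e⟩ := excess_eq h p
  constructor
  · intro h1
    rw [h1] at e
    linarith
  · intro h1
    rw [h1, mul_zero] at e
    rcases mul_eq_zero.1 e with h2 | h2 <;> linarith

theorem deltaTangentSphere_lt_iff {S T : Site} (h : 0 < gram S T T) (p : E3) :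
    deltaTangentSphere S p T.center < T.radius ↔ 0 < excess S T p := by
  obtain ⟨k, hk, e⟩ := excess_eq h p
  have : deltaTangentSphere S p T.center < T.radius ↔ 0 < S.delta p - T.delta p := by
    rw [deltaTangentSphere, Site.delta.eq_1 T, dist_comm]
    constructor <;> intro <;> linarith
  rw [this, ← mul_pos_iff_of_pos_right hk, e]
  constructor <;> intro <;> linarith

/-! ### The ends of a hyperbolic trisector -/

/-- The direction `w` in which a point moves to infinity while staying equidistant from `S` and `T`
is, as the null vector `(w, -1)`, Lorentz orthogonal to `T - S`. -/
theorem inner_disp_of_tendsto {S T : Site} (h : 0 < gram S T T) {f : ℝ → E3} {s : ℝ → ℝ} {v : E3}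
    (hf : ∀ τ, S.delta (f τ) = T.delta (f τ)) (hs : Tendsto s atTop atTop)
    (hv : Tendsto (fun τ => (s τ)⁻¹ • f τ) atTop (𝓝 v)) :
    inner ℝ v (disp S T) = -gap S T * ‖v‖ := by
  have h0 : Tendsto (fun τ => (s τ)⁻¹) atTop (𝓝 0) := tendsto_inv_atTop_zero.comp hs
  have h1 : Tendsto (fun τ => (s τ)⁻¹ • f τ - (s τ)⁻¹ • S.center) atTop (𝓝 v) := by
    simpa using hv.sub (h0.smul_const S.center)
  have h2 : Tendsto (fun τ => inner ℝ ((s τ)⁻¹ • f τ - (s τ)⁻¹ • S.center) (disp S T) +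
      gap S T * ‖(s τ)⁻¹ • f τ - (s τ)⁻¹ • S.center‖ - (s τ)⁻¹ * (gram S T T / 2)) atTop
      (𝓝 (inner ℝ v (disp S T) + gap S T * ‖v‖ - 0 * (gram S T T / 2))) :=
    ((h1.inner tendsto_const_nhds).add (h1.norm.const_mul _)).sub (h0.mul_const _)
  have h3 : ∀ᶠ τ in atTop, inner ℝ ((s τ)⁻¹ • f τ - (s τ)⁻¹ • S.center) (disp S T) +
      gap S T * ‖(s τ)⁻¹ • f τ - (s τ)⁻¹ • S.center‖ - (s τ)⁻¹ * (gram S T T / 2) = 0 := by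
    filter_upwards [hs.eventually_gt_atTop 0] with τ hτ
    have := (delta_eq_iff h (f τ)).1 (hf τ)
    rw [excess, dist_eq_norm] at this
    rw [← smul_sub, norm_smul, inner_smul_left, Real.norm_of_nonneg (by positivity)]
    simp only [conj_trivial]
    linear_combination (s τ)⁻¹ * this
  have h4 := tendsto_nhds_unique (tendsto_const_nhds.congr' (h3.mono fun _ h => h.symm)) h2
  linarith

/-- The unit vectors `w` such that the null vector `(w, -1)` is Lorentz orthogonal to `Sj - Si` and
to `Sk - Si`. -/
def IsEndDirection (Si Sj Sk : Site) (w : E3) : Prop :=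
  inner ℝ w w = 1 ∧ inner ℝ w (disp Si Sj) = -gap Si Sj ∧ inner ℝ w (disp Si Sk) = -gap Si Sk

theorem isEndDirection_of_tendsto {Si Sj Sk : Site} (hj : 0 < gram Si Sj Sj)
    (hk : 0 < gram Si Sk Sk) {f : ℝ → E3} {s : ℝ → ℝ} {v : E3}
    (hf : ∀ τ, f τ ∈ trisector Si Sj Sk) (hs : Tendsto s atTop atTop)
    (hv : Tendsto (fun τ => (s τ)⁻¹ • f τ) atTop (𝓝 v)) (h0 : v ≠ 0) :
    IsEndDirection Si Sj Sk (‖v‖⁻¹ • v) := by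
  have hn : ‖v‖ ≠ 0 := norm_ne_zero_iff.2 h0
  refine ⟨?_, ?_, ?_⟩
  · rw [inner_smul_left, inner_smul_right, real_inner_self_eq_norm_sq]
    simp only [conj_trivial]
    field_simp
  · rw [inner_smul_left, inner_disp_of_tendsto hj (fun τ => (hf τ).1) hs hv]
    simp only [conj_trivial]
    field_simp
  · rw [inner_smul_left, inner_disp_of_tendsto hk (fun τ => (hf τ).2) hs hv]
    simp only [conj_trivial]
    field_simp

theorem tendsto_branch (c e₁ e₂ : E3) (a b : ℝ) :
    Tendsto (fun t : ℝ => (Real.exp t)⁻¹ •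
      (c + (a * Real.cosh t) • e₁ + (b * Real.sinh t) • e₂)) atTop
      (𝓝 ((a / 2) • e₁ + (b / 2) • e₂)) := by
  have h0 : Tendsto (fun t : ℝ => (Real.exp t)⁻¹) atTop (𝓝 0) :=
    tendsto_inv_atTop_zero.comp Real.tendsto_exp_atTop
  have h1 : Tendsto (fun t : ℝ => (Real.exp t)⁻¹ • c +
      (a / 2 * (1 + (Real.exp t)⁻¹ * (Real.exp t)⁻¹)) • e₁ +
      (b / 2 * (1 - (Real.exp t)⁻¹ * (Real.exp t)⁻¹)) • e₂) atTop
      (𝓝 ((0 : ℝ) • c + (a / 2 * (1 + 0 * 0)) • e₁ + (b / 2 * (1 - 0 * 0)) • e₂)) :=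
    ((h0.smul_const c).add ((((h0.mul h0).const_add 1).const_mul (a / 2)).smul_const e₁)).add
      ((((h0.mul h0).const_sub 1).const_mul (b / 2)).smul_const e₂)
  have h2 : ((0 : ℝ) • c + (a / 2 * (1 + 0 * 0)) • e₁ + (b / 2 * (1 - 0 * 0)) • e₂) =
      (a / 2) • e₁ + (b / 2) • e₂ := by simp
  rw [h2] at h1
  refine h1.congr fun t => ?_
  rw [Real.cosh_eq, Real.sinh_eq, Real.exp_neg]
  have := Real.exp_pos t
  have hA : a / 2 * (1 + (Real.exp t)⁻¹ * (Real.exp t)⁻¹) =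
      (Real.exp t)⁻¹ * (a * ((Real.exp t + (Real.exp t)⁻¹) / 2)) := by field_simp
  have hB : b / 2 * (1 - (Real.exp t)⁻¹ * (Real.exp t)⁻¹) =
      (Real.exp t)⁻¹ * (b * ((Real.exp t - (Real.exp t)⁻¹) / 2)) := by field_simp
  rw [smul_add, smul_add, smul_smul, smul_smul, hA, hB]

/-- The two ends of a hyperbolic trisector have different directions. -/
theorem HyperbolicTriple.exists_isEndDirection {Si Sj Sk : Site} (h : HyperbolicTriple Si Sj Sk)
    (hj : 0 < gram Si Sj Sj) (hk : 0 < gram Si Sk Sk) :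
    ∃ w w', w ≠ w' ∧ IsEndDirection Si Sj Sk w ∧ IsEndDirection Si Sj Sk w' := by
  rcases h.hyperbolic with ⟨c, e₁, e₂, a, b, ha, hb, h1, h2, h12, hT⟩ | ⟨c, e, he, hT⟩
  · have key : ∀ b' : ℝ, ‖(a / 2) • e₁ + (b' / 2) • e₂‖ ^ 2 = (a / 2) ^ 2 + (b' / 2) ^ 2 := by
      intro b'
      rw [norm_add_sq_real, norm_smul, norm_smul, inner_smul_left, inner_smul_right, h12, h1, h2,
        mul_pow, mul_pow, Real.norm_eq_abs, Real.norm_eq_abs, sq_abs, sq_abs]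
      ring
    have ne : ∀ b' : ℝ, (a / 2) • e₁ + (b' / 2) • e₂ ≠ 0 := by
      intro b' h0
      have := key b'
      rw [h0, norm_zero] at this
      nlinarith [sq_nonneg b']
    have m1 : ∀ t : ℝ, c + (a * Real.cosh t) • e₁ + (b * Real.sinh t) • e₂ ∈
        trisector Si Sj Sk := by
      intro t
      rw [hT]
      exact ⟨t, rfl⟩
    have m2 : ∀ t : ℝ, c + (a * Real.cosh t) • e₁ + (-b * Real.sinh t) • e₂ ∈
        trisector Si Sj Sk := by
      intro t
      rw [hT]
      exact ⟨-t, by simp⟩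
    refine ⟨_, _, ?_,
      isEndDirection_of_tendsto hj hk m1 Real.tendsto_exp_atTop (tendsto_branch c e₁ e₂ a b) (ne b),
      isEndDirection_of_tendsto hj hk m2 Real.tendsto_exp_atTop (tendsto_branch c e₁ e₂ a (-b))
        (ne (-b))⟩
    have hn : ‖(a / 2) • e₁ + (-b / 2) • e₂‖ = ‖(a / 2) • e₁ + (b / 2) • e₂‖ := by
      rw [← abs_of_nonneg (norm_nonneg ((a / 2) • e₁ + (-b / 2) • e₂)),
        ← abs_of_nonneg (norm_nonneg ((a / 2) • e₁ + (b / 2) • e₂)), ← sq_eq_sq_iff_abs_eq_abs,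
        key, key]
      ring
    rw [hn]
    intro hc
    have hc := smul_right_injective E3 (inv_ne_zero (norm_ne_zero_iff.2 (ne b))) hc
    have hc : (b / 2) • e₂ = (-b / 2) • e₂ := add_left_cancel hc
    have he : e₂ ≠ 0 := by
      rintro rfl
      simp at h2
    have := smul_left_injective ℝ he hc
    linarith
  · have lim : ∀ e : E3, Tendsto (fun t : ℝ => t⁻¹ • (c + t • e)) atTop (𝓝 e) := by
      intro e
      have h1 : Tendsto (fun t : ℝ => t⁻¹ • c + e) atTop (𝓝 ((0 : ℝ) • c + e)) :=
        (tendsto_inv_atTop_zero.smul_const c).add_const e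
      rw [zero_smul, zero_add] at h1
      refine h1.congr' ?_
      filter_upwards [eventually_gt_atTop 0] with t ht
      rw [smul_add, inv_smul_smul₀ ht.ne']
    have m1 : ∀ t : ℝ, c + t • e ∈ trisector Si Sj Sk := by
      intro t
      rw [hT]
      exact ⟨t, rfl⟩
    have m2 : ∀ t : ℝ, c + t • (-e) ∈ trisector Si Sj Sk := by
      intro t
      rw [hT]
      exact ⟨-t, by simp⟩
    refine ⟨_, _, ?_, isEndDirection_of_tendsto hj hk m1 tendsto_id (lim e) he,
      isEndDirection_of_tendsto hj hk m2 tendsto_id (lim (-e)) (neg_ne_zero.2 he)⟩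
    rw [norm_neg]
    intro hc
    have hc : e = -e := smul_right_injective E3 (inv_ne_zero (norm_ne_zero_iff.2 he)) hc
    have h2 : (2 : ℝ) • e = 0 := by
      rw [two_smul]
      exact add_eq_zero_iff_eq_neg.2 hc
    exact he ((smul_eq_zero.1 h2).resolve_left two_ne_zero)

/-- The normal of the plane of the centers, oriented by the right-hand rule. -/
noncomputable def normal (Si Sj Sk : Site) : E3 := cross (disp Si Sj) (disp Si Sk)

/-- The squared length of `normal`. -/
noncomputable def normalSq (Si Sj Sk : Site) : ℝ := inner ℝ (normal Si Sj Sk) (normal Si Sj Sk)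

theorem normalSq_eq (Si Sj Sk : Site) : normalSq Si Sj Sk =
    inner ℝ (disp Si Sj) (disp Si Sj) * inner ℝ (disp Si Sk) (disp Si Sk) -
      inner ℝ (disp Si Sj) (disp Si Sk) ^ 2 :=
  inner_cross_self _ _

theorem gram_polarization (Si Sj Sk : Site) :
    gram Sj Sk Sk = gram Si Sj Sj - 2 * gram Si Sj Sk + gram Si Sk Sk := by
  have h : disp Sj Sk = disp Si Sk - disp Si Sj := by simp only [disp]; abel
  have h' : gap Sj Sk = gap Si Sk - gap Si Sj := by simp only [gap]; ring
  simp only [gram, h, h', inner_sub_left, inner_sub_right, real_inner_comm (disp Si Sj)]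
  ring

/-- The data of a hyperbolic trisector: the centers are not collinear, and the two ends of the
trisector have the directions `wp` (on the side of the thumb) and `wm`, which are mirror images in
the plane of the centers. -/
structure TrisectorFrame (Si Sj Sk : Site) where
  wp : E3
  wm : E3
  end_wp : IsEndDirection Si Sj Sk wp
  end_wm : IsEndDirection Si Sj Sk wm
  wp_pos : 0 < inner ℝ wp (normal Si Sj Sk)
  wm_eq : inner ℝ wm (normal Si Sj Sk) = -inner ℝ wp (normal Si Sj Sk)
  normalSq_pos : 0 < normalSq Si Sj Sk
  gram_j : 0 < gram Si Sj Sj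
  gram_k : 0 < gram Si Sk Sk
  gram_jk : 0 < gram Sj Sk Sk

/-- A vector orthogonal to the plane of the centers is a multiple of its normal. -/
theorem eq_smul_normal {Si Sj Sk : Site} (hG : normalSq Si Sj Sk ≠ 0) {x : E3}
    (hj : inner ℝ x (disp Si Sj) = 0) (hk : inner ℝ x (disp Si Sk) = 0) :
    x = (inner ℝ x (normal Si Sj Sk) / normalSq Si Sj Sk) • normal Si Sj Sk := by
  have h := cross_decomposition (disp Si Sj) (disp Si Sk) x
  rw [hj, hk] at h
  simp only [zero_mul, sub_self, zero_smul, zero_add] at h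
  rw [div_eq_inv_mul, mul_smul]
  refine ((inv_smul_eq_iff₀ hG).2 h.symm).symm

theorem HyperbolicTriple.nonempty_frame {Si Sj Sk : Site} (h : HyperbolicTriple Si Sj Sk) :
    Nonempty (TrisectorFrame Si Sj Sk) := by
  have hj : 0 < gram Si Sj Sj := gram_self_pos
    (abs_gap_lt (h.not_contained 0 1 (by decide)) (h.not_contained 1 0 (by decide)))
  have hk : 0 < gram Si Sk Sk := gram_self_pos
    (abs_gap_lt (h.not_contained 0 2 (by decide)) (h.not_contained 2 0 (by decide)))
  have hjk : 0 < gram Sj Sk Sk := gram_self_pos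
    (abs_gap_lt (h.not_contained 1 2 (by decide)) (h.not_contained 2 1 (by decide)))
  obtain ⟨w, w', hne, hw, hw'⟩ := h.exists_isEndDirection hj hk
  obtain ⟨p, hp⟩ : (trisector Si Sj Sk).Nonempty := by
    rcases h.hyperbolic with ⟨c, e₁, e₂, a, b, -, -, -, -, -, hT⟩ | ⟨c, e, -, hT⟩ <;>
    · rw [hT]
      exact Set.range_nonempty _
  have hG : normalSq Si Sj Sk ≠ 0 := by
    intro hG
    rw [normalSq_eq] at hG
    have hc : 0 < inner ℝ (disp Si Sj) (disp Si Sj) := by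
      unfold gram at hj
      nlinarith [mul_self_nonneg (gap Si Sj)]
    -- If the centers were collinear, the third one would be `l` times the second, seen from the
    -- first. The end directions give the same ratio of the radius differences, and the equations
    -- of a point of the trisector then leave only `l = 0` and `l = 1`.
    obtain ⟨l, hl⟩ : ∃ l : ℝ, disp Si Sk = l • disp Si Sj := by
      refine ⟨inner ℝ (disp Si Sj) (disp Si Sk) / inner ℝ (disp Si Sj) (disp Si Sj), ?_⟩
      rw [← sub_eq_zero, ← inner_self_eq_zero (𝕜 := ℝ)]
      simp only [inner_sub_left, inner_sub_right, inner_smul_left, inner_smul_right, conj_trivial,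
        real_inner_comm (disp Si Sj)]
      rw [real_inner_comm] at hG ⊢
      field_simp
      linear_combination hG
    have hb : gap Si Sk = l * gap Si Sj := by
      have h1 := hw.2.1
      have h2 := hw.2.2
      rw [hl, inner_smul_right] at h2
      linear_combination h2 - l * h1
    have e1 := (delta_eq_iff hj p).1 hp.1
    have e2 := (delta_eq_iff hk p).1 hp.2
    simp only [excess, hl, hb, inner_smul_right] at e1 e2
    have g2 : gram Si Sk Sk = l ^ 2 * gram Si Sj Sj := by
      simp only [gram, hl, hb, inner_smul_left, inner_smul_right, conj_trivial]
      ring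
    have g1 : gram Si Sj Sk = l * gram Si Sj Sj := by
      simp only [gram, hl, hb, inner_smul_right]
      ring
    have e3 : l * (l - 1) * gram Si Sj Sj = 0 := by
      rw [g2] at e2
      linear_combination 2 * l * e1 - 2 * e2
    have hpol := gram_polarization Si Sj Sk
    rw [g1, g2] at hpol
    rcases mul_eq_zero.1 ((mul_eq_zero.1 e3).resolve_right hj.ne') with h0 | h0
    · rw [g2, h0] at hk
      simp at hk
    · have : l = 1 := by linarith
      rw [hpol, this] at hjk
      linarith
  have hG0 : 0 < normalSq Si Sj Sk := lt_of_le_of_ne real_inner_self_nonneg hG.symm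
  have hd : w - w' =
      (inner ℝ (w - w') (normal Si Sj Sk) / normalSq Si Sj Sk) • normal Si Sj Sk := by
    refine eq_smul_normal hG ?_ ?_
    · rw [inner_sub_left, hw.2.1, hw'.2.1, sub_self]
    · rw [inner_sub_left, hw.2.2, hw'.2.2, sub_self]
  have hd0 : inner ℝ (w - w') (normal Si Sj Sk) ≠ 0 := by
    intro h0
    rw [h0, zero_div, zero_smul] at hd
    exact hne (sub_eq_zero.1 hd)
  have hs : inner ℝ (w + w') (w - w') = 0 := by
    rw [inner_add_left, inner_sub_right, inner_sub_right, hw.1, hw'.1, real_inner_comm]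
    ring
  rw [hd, inner_smul_right, inner_add_left] at hs
  have hs := (mul_eq_zero.1 hs).resolve_left (div_ne_zero hd0 hG)
  rw [inner_sub_left] at hd0
  rcases lt_trichotomy (inner ℝ w (normal Si Sj Sk)) 0 with h0 | h0 | h0
  · exact ⟨⟨w', w, hw', hw, by linarith, by linarith, hG0, hj, hk, hjk⟩⟩
  · exact absurd (by linarith) hd0
  · exact ⟨⟨w, w', hw, hw', h0, by linarith, hG0, hj, hk, hjk⟩⟩

/-! ### The hyperbola carrying the trisector -/

/-- The Gram determinant of `Sj - Si` and `Sk - Si` in Minkowski space. -/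
noncomputable def gramDet (Si Sj Sk : Site) : ℝ :=
  gram Si Sj Sj * gram Si Sk Sk - gram Si Sj Sk ^ 2

/-- In the coordinates `(x, -t)`, where `x` is the position and `t` the distance from the center of
`Si`, the center of the hyperbola carrying the trisector is the combination of `Sj - Si` and
`Sk - Si` with the coefficients `coefJ` and `coefK`. It is the point of their span that satisfies
the linear equations of the trisector. -/
noncomputable def coefJ (Si Sj Sk : Site) : ℝ :=
  gram Si Sk Sk * (gram Si Sj Sj - gram Si Sj Sk) / (2 * gramDet Si Sj Sk)

/-- The second coefficient of the center of the hyperbola; see `coefJ`. -/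
noncomputable def coefK (Si Sj Sk : Site) : ℝ :=
  gram Si Sj Sj * (gram Si Sk Sk - gram Si Sj Sk) / (2 * gramDet Si Sj Sk)

/-- The position of the center of the hyperbola, relative to the center of `Si`. -/
noncomputable def hub (Si Sj Sk : Site) : E3 :=
  coefJ Si Sj Sk • disp Si Sj + coefK Si Sj Sk • disp Si Sk

/-- The mean distance of opposite points of the hyperbola from the center of `Si`, those of the
second branch being counted negatively. -/
noncomputable def hubDist (Si Sj Sk : Site) : ℝ :=
  -(coefJ Si Sj Sk * gap Si Sj + coefK Si Sj Sk * gap Si Sk)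

/-- The Lorentzian square of the center of the hyperbola. -/
noncomputable def hubSq (Si Sj Sk : Site) : ℝ :=
  gram Si Sj Sj * gram Si Sk Sk * gram Sj Sk Sk / (4 * gramDet Si Sj Sk)

theorem inner_hub (Si Sj Sk S : Site) :
    inner ℝ (hub Si Sj Sk) (disp Si S) + hubDist Si Sj Sk * gap Si S =
      coefJ Si Sj Sk * gram Si Sj S + coefK Si Sj Sk * gram Si Sk S := by
  simp only [hub, hubDist, gram, inner_add_left, inner_smul_left, conj_trivial]
  ring

theorem inner_hub_normal (Si Sj Sk : Site) :
    inner ℝ (hub Si Sj Sk) (normal Si Sj Sk) = 0 := by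
  rw [hub, inner_add_left, real_inner_smul_left, real_inner_smul_left, normal, inner_left_cross,
    inner_right_cross]
  ring

namespace TrisectorFrame

variable {Si Sj Sk : Site}

/-- The component of `wp` along `normal`, not normalized. -/
noncomputable def height (T : TrisectorFrame Si Sj Sk) : ℝ := inner ℝ T.wp (normal Si Sj Sk)

theorem height_pos (T : TrisectorFrame Si Sj Sk) : 0 < T.height := T.wp_pos

theorem height_sq (T : TrisectorFrame Si Sj Sk) : T.height ^ 2 = gramDet Si Sj Sk := by
  have h := congrArg (inner ℝ T.wp) (cross_decomposition (disp Si Sj) (disp Si Sk) T.wp)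
  have e' : T.height = inner ℝ T.wp (cross (disp Si Sj) (disp Si Sk)) := rfl
  simp only [inner_add_right, inner_smul_right, T.end_wp.1, T.end_wp.2.1, T.end_wp.2.2,
    inner_cross_self, ← e'] at h
  simp only [gramDet, gram]
  linear_combination -h

theorem gramDet_pos (T : TrisectorFrame Si Sj Sk) : 0 < gramDet Si Sj Sk := by
  rw [← T.height_sq]
  exact pow_pos T.wp_pos 2

theorem hubSq_pos (T : TrisectorFrame Si Sj Sk) : 0 < hubSq Si Sj Sk := by
  have := T.gram_j
  have := T.gram_k
  have := T.gram_jk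
  have := T.gramDet_pos
  unfold hubSq
  positivity

theorem wp_sub_wm (T : TrisectorFrame Si Sj Sk) :
    T.wp - T.wm = (2 * T.height / normalSq Si Sj Sk) • normal Si Sj Sk := by
  have h : inner ℝ (T.wp - T.wm) (normal Si Sj Sk) = 2 * T.height := by
    rw [inner_sub_left, T.wm_eq, height]
    ring
  rw [← h]
  refine eq_smul_normal T.normalSq_pos.ne' ?_ ?_
  · rw [inner_sub_left, T.end_wp.2.1, T.end_wm.2.1, sub_self]
  · rw [inner_sub_left, T.end_wp.2.2, T.end_wm.2.2, sub_self]

theorem inner_wp_wm (T : TrisectorFrame Si Sj Sk) :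
    inner ℝ T.wp T.wm = 1 - 2 * T.height ^ 2 / normalSq Si Sj Sk := by
  have h := congrArg (fun x => inner ℝ T.wp x) T.wp_sub_wm
  simp only [inner_sub_right, inner_smul_right, T.end_wp.1] at h
  rw [← height] at h
  linear_combination -h

theorem inner_wm_wp (T : TrisectorFrame Si Sj Sk) :
    inner ℝ T.wm T.wp = 1 - 2 * T.height ^ 2 / normalSq Si Sj Sk := by
  rw [real_inner_comm, T.inner_wp_wm]

theorem inner_hub_j (T : TrisectorFrame Si Sj Sk) :
    inner ℝ (hub Si Sj Sk) (disp Si Sj) + hubDist Si Sj Sk * gap Si Sj =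
    gram Si Sj Sj / 2 := by
  have := T.gramDet_pos
  rw [inner_hub, coefJ, coefK, gram_comm Si Sk Sj]
  field_simp
  rw [gramDet]
  ring

theorem inner_hub_k (T : TrisectorFrame Si Sj Sk) :
    inner ℝ (hub Si Sj Sk) (disp Si Sk) + hubDist Si Sj Sk * gap Si Sk =
    gram Si Sk Sk / 2 := by
  have := T.gramDet_pos
  rw [inner_hub, coefJ, coefK]
  field_simp
  rw [gramDet]
  ring

theorem inner_hub_hub (T : TrisectorFrame Si Sj Sk) :
    inner ℝ (hub Si Sj Sk) (hub Si Sj Sk) = hubDist Si Sj Sk ^ 2 + hubSq Si Sj Sk := by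
  have hj := T.inner_hub_j
  have hk := T.inner_hub_k
  have h : inner ℝ (hub Si Sj Sk) (hub Si Sj Sk) - hubDist Si Sj Sk ^ 2 =
      coefJ Si Sj Sk * (gram Si Sj Sj / 2) + coefK Si Sj Sk * (gram Si Sk Sk / 2) := by
    nth_rw 2 [hub]
    rw [inner_add_right, inner_smul_right, inner_smul_right, ← hj, ← hk]
    simp only [hubDist]
    ring
  have := T.gramDet_pos
  have e : coefJ Si Sj Sk * (gram Si Sj Sj / 2) + coefK Si Sj Sk * (gram Si Sk Sk / 2) =
      hubSq Si Sj Sk := by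
    rw [hubSq, gram_polarization Si Sj Sk, coefJ, coefK]
    field_simp
    ring
  linear_combination h + e

theorem inner_end_hub {w : E3} (h : IsEndDirection Si Sj Sk w) :
    inner ℝ w (hub Si Sj Sk) = hubDist Si Sj Sk := by
  rw [hub, hubDist, inner_add_right, inner_smul_right, inner_smul_right, h.2.1, h.2.2]
  ring

theorem inner_hub_end {w : E3} (h : IsEndDirection Si Sj Sk w) :
    inner ℝ (hub Si Sj Sk) w = hubDist Si Sj Sk := by
  rw [real_inner_comm, inner_end_hub h]

/-- The scale of the hyperbola: its points are at distance `hubDist + scale * cosh θ` from the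
center of `Si`. -/
noncomputable def scale (T : TrisectorFrame Si Sj Sk) : ℝ :=
  √(hubSq Si Sj Sk * normalSq Si Sj Sk) / T.height

theorem scale_pos (T : TrisectorFrame Si Sj Sk) : 0 < T.scale :=
  div_pos (Real.sqrt_pos.2 (mul_pos T.hubSq_pos T.normalSq_pos)) T.height_pos

theorem scale_sq (T : TrisectorFrame Si Sj Sk) :
    T.scale ^ 2 * T.height ^ 2 = hubSq Si Sj Sk * normalSq Si Sj Sk := by
  have h : T.height ≠ 0 := T.height_pos.ne'
  rw [← mul_pow, scale, div_mul_cancel₀ _ h,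
    Real.sq_sqrt (mul_pos T.hubSq_pos T.normalSq_pos).le]

/-- The whole branch under consideration has positive distance from the center of `Si`. -/
theorem abs_hubDist_lt (T : TrisectorFrame Si Sj Sk) : |hubDist Si Sj Sk| < T.scale := by
  have hG := T.normalSq_pos
  have hH := T.height_pos
  -- The point at distance `0` on the axis of the hyperbola is not the center of `Si`, as it
  -- satisfies the linear equation of the bisector of `Si` and `Sj`.
  set u := hub Si Sj Sk - (hubDist Si Sj Sk / 2) • (T.wp + T.wm) with hu
  have h0 : u ≠ 0 := by
    intro h0
    have h1 : inner ℝ u (disp Si Sj) = gram Si Sj Sj / 2 := by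
      rw [← T.inner_hub_j, hu, inner_sub_left, inner_smul_left, inner_add_left, T.end_wp.2.1,
        T.end_wm.2.1]
      simp only [conj_trivial]
      ring
    rw [h0, inner_zero_left] at h1
    linarith [T.gram_j]
  have h1 : 0 < inner ℝ u u := real_inner_self_pos.2 h0
  have h2 : inner ℝ u u =
      hubSq Si Sj Sk - hubDist Si Sj Sk ^ 2 * (T.height ^ 2 / normalSq Si Sj Sk) := by
    rw [hu]
    simp only [inner_add_left, inner_sub_left, real_inner_smul_left, inner_add_right,
      inner_sub_right, real_inner_smul_right, T.end_wp.1, T.end_wm.1, T.inner_wp_wm, T.inner_wm_wp,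
      T.inner_hub_hub, inner_end_hub T.end_wp, inner_end_hub T.end_wm, inner_hub_end T.end_wp,
      inner_hub_end T.end_wm]
    ring
  have h3 : hubSq Si Sj Sk = T.scale ^ 2 * (T.height ^ 2 / normalSq Si Sj Sk) := by
    rw [← mul_div_assoc, T.scale_sq]
    field_simp
  rw [h2, h3, ← sub_mul] at h1
  have h4 : 0 < T.scale ^ 2 - hubDist Si Sj Sk ^ 2 :=
    pos_of_mul_pos_left h1 (by positivity)
  exact abs_lt_of_sq_lt_sq (by linarith) T.scale_pos.le

/-- The parametrization of the trisector, relative to the center of `Si`. -/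
noncomputable def offset (T : TrisectorFrame Si Sj Sk) (θ : ℝ) : E3 :=
  hub Si Sj Sk + (T.scale / 2 * Real.exp θ) • T.wp + (T.scale / 2 * Real.exp (-θ)) • T.wm

/-- The parametrization of the trisector by hyperbolic angle. -/
noncomputable def point (T : TrisectorFrame Si Sj Sk) (θ : ℝ) : E3 := Si.center + T.offset θ

theorem point_sub (T : TrisectorFrame Si Sj Sk) (θ : ℝ) : T.point θ - Si.center = T.offset θ := by
  simp [point]

theorem inner_offset (T : TrisectorFrame Si Sj Sk) (θ : ℝ) (x : E3) :
    inner ℝ (T.offset θ) x = inner ℝ (hub Si Sj Sk) x +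
    T.scale / 2 * Real.exp θ * inner ℝ T.wp x + T.scale / 2 * Real.exp (-θ) * inner ℝ T.wm x := by
  simp only [offset, inner_add_left, inner_smul_left, conj_trivial]

theorem dist_point (T : TrisectorFrame Si Sj Sk) (θ : ℝ) :
    dist (T.point θ) Si.center = hubDist Si Sj Sk + T.scale * Real.cosh θ := by
  have h1 : 0 ≤ hubDist Si Sj Sk + T.scale * Real.cosh θ := by
    have := neg_abs_le (hubDist Si Sj Sk)
    have := T.abs_hubDist_lt
    have := Real.one_le_cosh θ
    nlinarith [T.scale_pos]
  rw [dist_eq_norm, point_sub, ← abs_of_nonneg (norm_nonneg (T.offset θ)), ← abs_of_nonneg h1,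
    ← sq_eq_sq_iff_abs_eq_abs, ← real_inner_self_eq_norm_sq]
  simp only [offset, inner_add_left, real_inner_smul_left, inner_add_right,
      real_inner_smul_right, T.end_wp.1, T.end_wm.1, T.inner_wp_wm, T.inner_wm_wp,
      T.inner_hub_hub, inner_end_hub T.end_wp, inner_end_hub T.end_wm, inner_hub_end T.end_wp,
      inner_hub_end T.end_wm]
  have e : Real.exp θ * Real.exp (-θ) = 1 := by rw [← Real.exp_add]; simp
  have h3 : hubSq Si Sj Sk = T.scale ^ 2 * (T.height ^ 2 / normalSq Si Sj Sk) := by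
    rw [← mul_div_assoc, T.scale_sq]
    field_simp [T.normalSq_pos.ne']
  rw [Real.cosh_eq, h3]
  linear_combination (-(T.scale ^ 2 * (T.height ^ 2 / normalSq Si Sj Sk))) * e

end TrisectorFrame

/-! ### The parametrization of the trisector -/

/-- The value of `excess Si S` at the center of the hyperbola, that is, the constant coefficient of
`excess Si S` along the trisector. -/
noncomputable def coefZero (Si Sj Sk S : Site) : ℝ :=
  coefJ Si Sj Sk * gram Si Sj S + coefK Si Sj Sk * gram Si Sk S - gram Si S S / 2

theorem mem_affineSpan_centers_iff {Si Sj Sk : Site} (hG : normalSq Si Sj Sk ≠ 0) (p : E3) :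
    p ∈ (affineSpan ℝ {Si.center, Sj.center, Sk.center} : Set E3) ↔
      inner ℝ (p - Si.center) (normal Si Sj Sk) = 0 := by
  have h1 : p ∈ affineSpan ℝ {Si.center, Sj.center, Sk.center} ↔
      p - Si.center ∈ Submodule.span ℝ {disp Si Sj, disp Si Sk} := by
    rw [← AffineSubspace.vsub_right_mem_direction_iff_mem
      (mem_affineSpan ℝ (Set.mem_insert Si.center {Sj.center, Sk.center})) p,
      direction_affineSpan, vectorSpan_eq_span_vsub_set_right ℝ
      (Set.mem_insert Si.center {Sj.center, Sk.center}), Set.image_insert_eq, Set.image_pair,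
      vsub_self, Submodule.span_insert_zero]
    rfl
  rw [SetLike.mem_coe, h1, Submodule.mem_span_pair]
  constructor
  · rintro ⟨x, y, h⟩
    rw [← h, inner_add_left, real_inner_smul_left, real_inner_smul_left, normal, inner_left_cross,
      inner_right_cross]
    ring
  · intro h
    have h2 := cross_decomposition (disp Si Sj) (disp Si Sk) (p - Si.center)
    rw [← normal, h, zero_smul, add_zero, ← normalSq] at h2
    rw [← (inv_smul_eq_iff₀ hG).2 h2.symm, ← Submodule.mem_span_pair]
    exact Submodule.smul_mem _ _ (Submodule.mem_span_pair.2 ⟨_, _, rfl⟩)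

namespace TrisectorFrame
variable {Si Sj Sk : Site}

/-- The coefficient of `exp θ` in `excess Si S` along the trisector. -/
noncomputable def coefPlus (T : TrisectorFrame Si Sj Sk) (S : Site) : ℝ :=
  T.scale / 2 * (inner ℝ T.wp (disp Si S) + gap Si S)

/-- The coefficient of `exp (-θ)` in `excess Si S` along the trisector. -/
noncomputable def coefMinus (T : TrisectorFrame Si Sj Sk) (S : Site) : ℝ :=
  T.scale / 2 * (inner ℝ T.wm (disp Si S) + gap Si S)

theorem excess_point (T : TrisectorFrame Si Sj Sk) (S : Site) (θ : ℝ) :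
    excess Si S (T.point θ) = T.coefPlus S * Real.exp θ + coefZero Si Sj Sk S +
      T.coefMinus S * Real.exp (-θ) := by
  rw [excess, point_sub, inner_offset, dist_point, coefZero, ← inner_hub, Real.cosh_eq, coefPlus,
    coefMinus]
  ring

theorem point_mem (T : TrisectorFrame Si Sj Sk) (θ : ℝ) : T.point θ ∈ trisector Si Sj Sk := by
  constructor
  · rw [delta_eq_iff T.gram_j, T.excess_point, coefPlus, coefMinus, coefZero, ← inner_hub,
      T.inner_hub_j, T.end_wp.2.1, T.end_wm.2.1]
    ring
  · rw [delta_eq_iff T.gram_k, T.excess_point, coefPlus, coefMinus, coefZero, ← inner_hub,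
      T.inner_hub_k, T.end_wp.2.2, T.end_wm.2.2]
    ring

/-- The parametrization covers the trisector: the only points of the hyperbola that it misses are on
the other branch, which has negative `t` by `abs_hubDist_lt`. -/
theorem exists_point_eq (T : TrisectorFrame Si Sj Sk) {p : E3} (hp : p ∈ trisector Si Sj Sk) :
    ∃ θ, T.point θ = p := by
  have ej := (delta_eq_iff T.gram_j p).1 hp.1
  have ek := (delta_eq_iff T.gram_k p).1 hp.2
  have hG := T.normalSq_pos.ne'
  have hH : T.height ≠ 0 := T.height_pos.ne'
  have hρ := T.scale_pos
  unfold excess at ej ek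
  set t := dist p Si.center with ht
  set x := p - Si.center with hx
  set s := t - hubDist Si Sj Sk with hs
  set η := inner ℝ x (normal Si Sj Sk) / T.height with hη
  -- The component of `p` in the plane of the centers is an affine function of its distance.
  have hy : x - hub Si Sj Sk - (s / 2) • (T.wp + T.wm) = (η / 2) • (T.wp - T.wm) := by
    have h := eq_smul_normal (x := x - hub Si Sj Sk - (s / 2) • (T.wp + T.wm)) hG ?_ ?_
    · rw [h, T.wp_sub_wm, smul_smul]
      congr 1
      rw [inner_sub_left, inner_sub_left, real_inner_smul_left, inner_add_left, T.wm_eq,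
        inner_hub_normal, hη]
      field_simp
      ring
    · rw [inner_sub_left, inner_sub_left, real_inner_smul_left, inner_add_left, T.end_wp.2.1,
        T.end_wm.2.1]
      linear_combination ej - T.inner_hub_j
    · rw [inner_sub_left, inner_sub_left, real_inner_smul_left, inner_add_left, T.end_wp.2.2,
        T.end_wm.2.2]
      linear_combination ek - T.inner_hub_k
  have hx' : x = hub Si Sj Sk + ((s + η) / 2) • T.wp + ((s - η) / 2) • T.wm := by
    rw [sub_eq_iff_eq_add, sub_eq_iff_eq_add] at hy
    rw [hy]
    module
  have hsq : (s + η) * (s - η) = T.scale ^ 2 := by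
    have h1 : inner ℝ x x = t ^ 2 := by
      rw [real_inner_self_eq_norm_sq, ht, dist_eq_norm]
    rw [hx'] at h1
    simp only [inner_add_left, real_inner_smul_left, inner_add_right,
      real_inner_smul_right, T.end_wp.1, T.end_wm.1, T.inner_wp_wm, T.inner_wm_wp,
      T.inner_hub_hub, inner_end_hub T.end_wp, inner_end_hub T.end_wm, inner_hub_end T.end_wp,
      inner_hub_end T.end_wm] at h1
    have h2 := T.scale_sq
    have h3 : t = s + hubDist Si Sj Sk := by rw [hs]; ring
    rw [h3] at h1
    have h4 : ((s + η) * (s - η) - T.scale ^ 2) * T.height ^ 2 = 0 := by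
      field_simp at h1
      linear_combination -h1 / 4 - h2
    have := (mul_eq_zero.1 h4).resolve_right (pow_ne_zero 2 hH)
    linarith
  have hs0 : 0 < s := by
    have h1 : 0 ≤ t := dist_nonneg
    have h2 := le_abs_self (hubDist Si Sj Sk)
    have h3 := T.abs_hubDist_lt
    have h4 : -T.scale < s := by rw [hs]; linarith
    by_contra h5
    nlinarith [sq_nonneg η]
  have h1 : 0 < s + η := by
    by_contra h5
    nlinarith [sq_pos_of_pos hρ]
  have e1 : Real.exp (Real.log ((s + η) / T.scale)) = (s + η) / T.scale :=
    Real.exp_log (by positivity)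
  refine ⟨Real.log ((s + η) / T.scale), ?_⟩
  rw [point, offset, Real.exp_neg, e1, inv_div]
  have e2 : T.scale / 2 * ((s + η) / T.scale) = (s + η) / 2 := by field_simp
  have e3 : T.scale / 2 * (T.scale / (s + η)) = (s - η) / 2 := by
    field_simp
    linear_combination -hsq
  rw [e2, e3, ← hx', hx]
  abel

theorem orientDet_point (T : TrisectorFrame Si Sj Sk) (θ : ℝ) :
    orientDet (T.point θ) Si.center Sj.center Sk.center = T.scale * T.height * Real.sinh θ := by
  rw [orientDet_eq_inner_cross, point_sub, ← disp, ← disp, ← normal, inner_offset, T.wm_eq,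
    inner_hub_normal, ← height, Real.sinh_eq]
  ring

theorem trisector_inter_affineSpan (T : TrisectorFrame Si Sj Sk) :
    trisector Si Sj Sk ∩ (affineSpan ℝ {Si.center, Sj.center, Sk.center} : Set E3) =
      {T.point 0} := by
  have key : ∀ θ, T.point θ ∈ (affineSpan ℝ {Si.center, Sj.center, Sk.center} : Set E3) ↔
      θ = 0 := by
    intro θ
    have h := T.orientDet_point θ
    rw [orientDet_eq_inner_cross, ← disp, ← disp, ← normal] at h
    have h0 : T.scale * T.height ≠ 0 := (mul_pos T.scale_pos T.height_pos).ne'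
    rw [mem_affineSpan_centers_iff T.normalSq_pos.ne', h, mul_eq_zero, or_iff_right h0,
      Real.sinh_eq_zero]
  ext p
  constructor
  · rintro ⟨h1, h2⟩
    obtain ⟨θ, rfl⟩ := T.exists_point_eq h1
    rw [(key θ).1 h2]
    rfl
  · rintro rfl
    exact ⟨T.point_mem 0, (key 0).2 rfl⟩

theorem trisectorOrigin_eq (T : TrisectorFrame Si Sj Sk) :
    trisectorOrigin Si Sj Sk = T.point 0 := by
  have h : trisectorOrigin Si Sj Sk ∈
      trisector Si Sj Sk ∩ (affineSpan ℝ {Si.center, Sj.center, Sk.center} : Set E3) :=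
    Classical.epsilon_spec (p := fun o => o ∈ trisector Si Sj Sk ∩
      (affineSpan ℝ {Si.center, Sj.center, Sk.center} : Set E3))
      ⟨T.point 0, by rw [T.trisector_inter_affineSpan]; rfl⟩
  rw [T.trisector_inter_affineSpan] at h
  exact h

theorem zeta_point (T : TrisectorFrame Si Sj Sk) (θ : ℝ) : zeta Si Sj Sk (T.point θ) =
    2 * T.scale * (Real.sinh (θ / 2) * |Real.sinh (θ / 2)|) := by
  have h1 : Si.delta (T.point θ) - Si.delta (T.point 0) =
      2 * T.scale * Real.sinh (θ / 2) ^ 2 := by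
    have h2 := Real.cosh_two_mul (θ / 2)
    have h3 := Real.cosh_sq (θ / 2)
    rw [mul_div_cancel₀ θ two_ne_zero] at h2
    rw [Site.delta, Site.delta, dist_point, dist_point, Real.cosh_zero, h2, h3]
    ring
  have h2 : 0 < orientDet (T.point θ) Si.center Sj.center Sk.center ↔ 0 < Real.sinh (θ / 2) := by
    rw [orientDet_point, mul_pos_iff_of_pos_left (mul_pos T.scale_pos T.height_pos),
      Real.sinh_pos_iff, Real.sinh_pos_iff]
    constructor <;> intro <;> linarith
  rw [zeta, T.trisectorOrigin_eq, h1]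
  simp only [h2]
  split_ifs with h
  · rw [abs_of_pos h]
    ring
  · rw [abs_of_nonpos (not_lt.1 h)]
    ring

/-- The parameter `θ` runs in the direction of the orientation of the trisector. -/
theorem strictMono_zeta_point (T : TrisectorFrame Si Sj Sk) :
    StrictMono fun θ => zeta Si Sj Sk (T.point θ) := by
  intro x y hxy
  simp only [zeta_point]
  have h : Real.sinh (x / 2) < Real.sinh (y / 2) := Real.sinh_lt_sinh.2 (by linarith)
  have : 0 < 2 * T.scale := by linarith [T.scale_pos]
  gcongr 2 * T.scale * ?_
  rcases abs_cases (Real.sinh (x / 2)) with ⟨e, _⟩ | ⟨e, _⟩ <;>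
  rcases abs_cases (Real.sinh (y / 2)) with ⟨e', _⟩ | ⟨e', _⟩ <;> rw [e, e'] <;> nlinarith

theorem surjective_zeta_point (T : TrisectorFrame Si Sj Sk) :
    Function.Surjective fun θ => zeta Si Sj Sk (T.point θ) := by
  intro y
  have hρ := T.scale_pos
  have key : ∀ s : ℝ, zeta Si Sj Sk (T.point (2 * Real.arsinh s)) = 2 * T.scale * (s * |s|) := by
    intro s
    rw [zeta_point, mul_div_cancel_left₀ _ two_ne_zero, Real.sinh_arsinh]
  rcases le_total 0 y with h | h
  · refine ⟨2 * Real.arsinh (√(y / (2 * T.scale))), ?_⟩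
    simp only [key]
    rw [abs_of_nonneg (Real.sqrt_nonneg _), Real.mul_self_sqrt (by positivity)]
    field_simp
  · refine ⟨2 * Real.arsinh (-√(-y / (2 * T.scale))), ?_⟩
    simp only [key]
    rw [abs_neg, abs_of_nonneg (Real.sqrt_nonneg _), neg_mul,
      Real.mul_self_sqrt (div_nonneg (by linarith) (by linarith))]
    field_simp

/-- The coordinate `ζ` as a function of the hyperbolic angle. -/
noncomputable def zetaIso (T : TrisectorFrame Si Sj Sk) : ℝ ≃o ℝ :=
  T.strictMono_zeta_point.orderIsoOfSurjective _ T.surjective_zeta_point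

theorem zetaIso_apply (T : TrisectorFrame Si Sj Sk) (θ : ℝ) :
    T.zetaIso θ = zeta Si Sj Sk (T.point θ) := rfl

theorem bijOn_zeta (T : TrisectorFrame Si Sj Sk) :
    Set.BijOn (zeta Si Sj Sk) (trisector Si Sj Sk) Set.univ := by
  refine ⟨fun _ _ => Set.mem_univ _, ?_, ?_⟩
  · intro p hp q hq h
    obtain ⟨θ, rfl⟩ := T.exists_point_eq hp
    obtain ⟨θ', rfl⟩ := T.exists_point_eq hq
    rw [T.strictMono_zeta_point.injective h]
  · intro y _
    obtain ⟨θ, h⟩ := T.surjective_zeta_point y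
    exact ⟨T.point θ, T.point_mem θ, h⟩

end TrisectorFrame

/-! ### The planes at infinity -/

/-- If `x` runs to infinity in the direction of `v`, then the spheres with center `x` that pass
through the origin tend to a plane. -/
theorem tendsto_norm_sub_sub_norm {l : Filter ℝ} {x : ℝ → E3} {k : ℝ → ℝ} {v : E3}
    (hk : Tendsto k l (𝓝 0)) (hk0 : ∀ θ, 0 < k θ) (hx : Tendsto (fun θ => k θ • x θ) l (𝓝 v))
    (hv : v ≠ 0) (y : E3) :
    Tendsto (fun θ => ‖x θ - y‖ - ‖x θ‖) l (𝓝 (-inner ℝ v y / ‖v‖)) := by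
  have hn : 0 < ‖v‖ := norm_pos_iff.2 hv
  have h1 : Tendsto (fun θ => (k θ * ‖y‖ ^ 2 - 2 * inner ℝ (k θ • x θ) y) /
      (‖k θ • x θ - k θ • y‖ + ‖k θ • x θ‖)) l
      (𝓝 ((0 * ‖y‖ ^ 2 - 2 * inner ℝ v y) / (‖v - (0 : ℝ) • y‖ + ‖v‖))) := by
    refine ((hk.mul_const _).sub ((hx.inner tendsto_const_nhds).const_mul 2)).div
      ((hx.sub (hk.smul_const y)).norm.add hx.norm) ?_
    rw [zero_smul, sub_zero]
    linarith
  have e : (0 * ‖y‖ ^ 2 - 2 * inner ℝ v y) / (‖v - (0 : ℝ) • y‖ + ‖v‖) = -inner ℝ v y / ‖v‖ := by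
    rw [zero_smul, sub_zero]
    field_simp
    ring
  rw [e] at h1
  refine h1.congr' ?_
  filter_upwards [hx.norm.eventually (lt_mem_nhds hn)] with θ hθ
  have h2 := norm_sub_sq_real (x θ) y
  rw [norm_smul, Real.norm_of_nonneg (hk0 θ).le] at hθ
  have h3 : 0 < ‖x θ‖ := pos_of_mul_pos_right hθ (hk0 θ).le
  have h4 : 0 < ‖x θ - y‖ + ‖x θ‖ := by positivity
  have h5 := hk0 θ
  rw [← smul_sub, norm_smul, norm_smul, Real.norm_of_nonneg h5.le, real_inner_smul_left,
    ← mul_add, div_eq_iff (by positivity)]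
  linear_combination k θ * (-h2)

/-- The plane tangent to `Si` whose normal is opposite to the direction `w`. -/
noncomputable def endPlane (Si : Site) (w : E3) (h : inner ℝ w w = 1) : OrientedPlane where
  normal := -w
  offset := inner ℝ w Si.center + Si.radius
  norm_normal := by
    rw [norm_neg, ← sq_eq_sq₀ (norm_nonneg _) zero_le_one, ← real_inner_self_eq_norm_sq, h, one_pow]

theorem signedDist_endPlane (Si : Site) (w : E3) (h : inner ℝ w w = 1) (x : E3) :
    (endPlane Si w h).signedDist x = -inner ℝ w (x - Si.center) + Si.radius := by
  simp only [OrientedPlane.signedDist, endPlane, inner_neg_left, inner_sub_right]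
  ring

theorem siteDist_endPlane (Si : Site) (w : E3) (h : inner ℝ w w = 1) (S : Site) :
    (endPlane Si w h).siteDist S = -(inner ℝ w (disp Si S) + gap Si S) := by
  rw [OrientedPlane.siteDist, signedDist_endPlane, disp, gap]
  ring

theorem OrientedPlane.ext_signedDist {Q Q' : OrientedPlane}
    (h : ∀ x, Q.signedDist x = Q'.signedDist x) : Q = Q' := by
  have h0 : Q.offset = Q'.offset := by simpa [signedDist] using h 0
  refine OrientedPlane.ext ?_ h0
  refine ext_inner_right ℝ fun x => ?_
  have := h x
  rw [signedDist, signedDist, h0] at this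
  linarith

theorem OrientedPlane.inner_neg_normal_self (Q : OrientedPlane) :
    inner ℝ (-Q.normal) (-Q.normal) = (1 : ℝ) := by
  rw [inner_neg_neg, real_inner_self_eq_norm_sq, Q.norm_normal, one_pow]

/-- The common tangent planes correspond to the end directions. -/
theorem mem_commonTangentPlanes_iff {Si Sj Sk : Site} (Q : OrientedPlane) :
    Q ∈ commonTangentPlanes Si Sj Sk ↔
      ∃ (w : E3) (h : IsEndDirection Si Sj Sk w), Q = endPlane Si w h.1 := by
  constructor
  · rintro ⟨h1, h2, h3⟩
    simp only [OrientedPlane.siteDist, OrientedPlane.signedDist] at h1 h2 h3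
    refine ⟨-Q.normal, ⟨OrientedPlane.inner_neg_normal_self Q, ?_, ?_⟩, ?_⟩
    · rw [inner_neg_left, disp, gap, inner_sub_right]
      linarith
    · rw [inner_neg_left, disp, gap, inner_sub_right]
      linarith
    · refine OrientedPlane.ext (neg_neg _).symm ?_
      simp only [endPlane, inner_neg_left]
      linarith
  · rintro ⟨w, h, rfl⟩
    refine ⟨?_, ?_, ?_⟩
    · rw [siteDist_endPlane]
      simp [disp, gap]
    · rw [siteDist_endPlane, h.2.1]
      ring
    · rw [siteDist_endPlane, h.2.2]
      ring

namespace TrisectorFrame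
variable {Si Sj Sk : Site}

theorem eq_or_eq_of_isEndDirection (T : TrisectorFrame Si Sj Sk) {w : E3}
    (h : IsEndDirection Si Sj Sk w) : w = T.wm ∨ w = T.wp := by
  have hG := T.normalSq_pos.ne'
  have hH := T.height_pos.ne'
  have hd : w - T.wm = (inner ℝ (w - T.wm) (normal Si Sj Sk) / (2 * T.height)) •
      (T.wp - T.wm) := by
    rw [T.wp_sub_wm, smul_smul]
    have h1 := eq_smul_normal (x := w - T.wm) hG
      (by rw [inner_sub_left, h.2.1, T.end_wm.2.1, sub_self])
      (by rw [inner_sub_left, h.2.2, T.end_wm.2.2, sub_self])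
    refine h1.trans ?_
    congr 1
    field_simp
  set s := inner ℝ (w - T.wm) (normal Si Sj Sk) / (2 * T.height)
  have hw : w = T.wm + s • (T.wp - T.wm) := by rw [← hd]; abel
  have h1 := h.1
  rw [hw] at h1
  simp only [inner_add_left, inner_sub_left, real_inner_smul_left, inner_add_right,
    inner_sub_right, real_inner_smul_right, T.end_wp.1, T.end_wm.1, T.inner_wp_wm,
    T.inner_wm_wp] at h1
  have h2 : s * (s - 1) = 0 := by
    have h3 : s * (s - 1) * (T.height ^ 2 * 4) = 0 := by
      field_simp at h1
      linear_combination h1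
    exact (mul_eq_zero.1 h3).resolve_right (by positivity)
  rcases mul_eq_zero.1 h2 with h3 | h3
  · left
    rw [hw, h3, zero_smul, add_zero]
  · right
    rw [hw, sub_eq_zero.1 h3, one_smul]
    abel

theorem wm_ne_wp (T : TrisectorFrame Si Sj Sk) : T.wm ≠ T.wp := by
  intro h
  have h1 := T.wm_eq
  have h2 := T.wp_pos
  rw [h] at h1
  linarith

/-- Limits along the trisector can be computed in the parametrization. -/
theorem tendsto_of_tendsto_point (T : TrisectorFrame Si Sj Sk) {f : E3 → ℝ} {l l' : Filter ℝ}
    {y : ℝ}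
    (hl : Tendsto T.zetaIso.symm l l') (hf : Tendsto (fun θ => f (T.point θ)) l' (𝓝 y)) :
    Tendsto f (comap (zeta Si Sj Sk) l ⊓ 𝓟 (trisector Si Sj Sk)) (𝓝 y) := by
  have h : Tendsto (fun p => f (T.point (T.zetaIso.symm (zeta Si Sj Sk p))))
      (comap (zeta Si Sj Sk) l ⊓ 𝓟 (trisector Si Sj Sk)) (𝓝 y) :=
    (hf.comp (hl.comp tendsto_comap)).mono_left inf_le_left
  refine h.congr' ?_
  filter_upwards [mem_inf_of_right (mem_principal_self _)] with p hp
  obtain ⟨θ, rfl⟩ := T.exists_point_eq hp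
  rw [← T.zetaIso_apply, OrderIso.symm_apply_apply]

theorem neBot_comap_zeta (T : TrisectorFrame Si Sj Sk) (l : Filter ℝ) [hl : l.NeBot] :
    (comap (zeta Si Sj Sk) l ⊓ 𝓟 (trisector Si Sj Sk)).NeBot :=
  comap_inf_principal_neBot_of_image_mem hl (by rw [T.bijOn_zeta.image_eq]; exact univ_mem)

theorem isPlaneAtInfinity_unique (T : TrisectorFrame Si Sj Sk) {l : Filter ℝ} [l.NeBot]
    {Q Q' : OrientedPlane} (h : IsPlaneAtInfinity Si Sj Sk l Q)
    (h' : IsPlaneAtInfinity Si Sj Sk l Q') : Q = Q' := by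
  have := T.neBot_comap_zeta l
  exact OrientedPlane.ext_signedDist fun x => tendsto_nhds_unique (h.2 x) (h'.2 x)

theorem isPlaneAtInfinity_endPlane (T : TrisectorFrame Si Sj Sk) {l l' : Filter ℝ}
    (hl : Tendsto T.zetaIso.symm l l') {w : E3} (hw : IsEndDirection Si Sj Sk w) {k : ℝ → ℝ}
    (hk : Tendsto k l' (𝓝 0)) (hk0 : ∀ θ, 0 < k θ)
    (hx : Tendsto (fun θ => k θ • T.offset θ) l' (𝓝 ((T.scale / 2) • w))) :
    IsPlaneAtInfinity Si Sj Sk l (endPlane Si w hw.1) := by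
  refine ⟨(mem_commonTangentPlanes_iff _).2 ⟨w, hw, rfl⟩, fun x => ?_⟩
  refine T.tendsto_of_tendsto_point hl ?_
  have hs := T.scale_pos
  have hw1 : ‖w‖ = 1 := by
    rw [← sq_eq_sq₀ (norm_nonneg _) zero_le_one, ← real_inner_self_eq_norm_sq, hw.1, one_pow]
  have hv : (T.scale / 2) • w ≠ 0 := by
    refine smul_ne_zero (by positivity) fun h => ?_
    simp [h] at hw1
  have h := (tendsto_norm_sub_sub_norm hk hk0 hx hv (x - Si.center)).add_const Si.radius
  have e : -inner ℝ ((T.scale / 2) • w) (x - Si.center) / ‖(T.scale / 2) • w‖ + Si.radius =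
      (endPlane Si w hw.1).signedDist x := by
    rw [signedDist_endPlane, norm_smul, hw1, Real.norm_of_nonneg (by positivity),
      real_inner_smul_left]
    field_simp
  rw [e] at h
  refine h.congr fun θ => ?_
  rw [deltaTangentSphere, Site.delta, dist_comm, dist_eq_norm, dist_eq_norm, ← point_sub]
  have : T.point θ - Si.center - (x - Si.center) = T.point θ - x := by abel
  rw [this]
  ring

theorem isPlaneAtInfinity_atTop (T : TrisectorFrame Si Sj Sk) :
    IsPlaneAtInfinity Si Sj Sk atTop (endPlane Si T.wp T.end_wp.1) := by
  have hk : Tendsto (fun θ : ℝ => Real.exp (-θ)) atTop (𝓝 0) :=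
    Real.tendsto_exp_neg_atTop_nhds_zero
  refine T.isPlaneAtInfinity_endPlane T.zetaIso.symm.tendsto_atTop T.end_wp hk
    (fun θ => Real.exp_pos _) ?_
  have h : Tendsto (fun θ : ℝ => Real.exp (-θ) • hub Si Sj Sk + (T.scale / 2) • T.wp +
      (T.scale / 2 * (Real.exp (-θ) * Real.exp (-θ))) • T.wm) atTop
      (𝓝 ((0 : ℝ) • hub Si Sj Sk + (T.scale / 2) • T.wp + (T.scale / 2 * (0 * 0)) • T.wm)) :=
    ((hk.smul_const _).add_const _).add (((hk.mul hk).const_mul _).smul_const _)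
  rw [zero_smul, zero_add, mul_zero, mul_zero, zero_smul, add_zero] at h
  refine h.congr fun θ => ?_
  have e : Real.exp (-θ) * (T.scale / 2 * Real.exp θ) = T.scale / 2 := by
    rw [mul_left_comm, ← Real.exp_add, neg_add_cancel, Real.exp_zero, mul_one]
  rw [offset, smul_add, smul_add, smul_smul, smul_smul, e]
  congr 2
  ring

theorem isPlaneAtInfinity_atBot (T : TrisectorFrame Si Sj Sk) :
    IsPlaneAtInfinity Si Sj Sk atBot (endPlane Si T.wm T.end_wm.1) := by
  have hk : Tendsto Real.exp atBot (𝓝 0) := Real.tendsto_exp_atBot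
  refine T.isPlaneAtInfinity_endPlane T.zetaIso.symm.tendsto_atBot T.end_wm hk
    (fun θ => Real.exp_pos _) ?_
  have h : Tendsto (fun θ : ℝ => Real.exp θ • hub Si Sj Sk +
      (T.scale / 2 * (Real.exp θ * Real.exp θ)) • T.wp + (T.scale / 2) • T.wm) atBot
      (𝓝 ((0 : ℝ) • hub Si Sj Sk + (T.scale / 2 * (0 * 0)) • T.wp + (T.scale / 2) • T.wm)) :=
    ((hk.smul_const _).add (((hk.mul hk).const_mul _).smul_const _)).add_const _
  rw [zero_smul, zero_add, mul_zero, mul_zero, zero_smul, zero_add] at h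
  refine h.congr fun θ => ?_
  have e : Real.exp θ * (T.scale / 2 * Real.exp (-θ)) = T.scale / 2 := by
    rw [mul_left_comm, ← Real.exp_add, add_neg_cancel, Real.exp_zero, mul_one]
  rw [offset, smul_add, smul_add, smul_smul, smul_smul, e]
  congr 3
  ring

theorem planePlus_eq (T : TrisectorFrame Si Sj Sk) :
    planePlus Si Sj Sk = endPlane Si T.wp T.end_wp.1 :=
  T.isPlaneAtInfinity_unique (Classical.epsilon_spec ⟨_, T.isPlaneAtInfinity_atTop⟩)
    T.isPlaneAtInfinity_atTop

theorem planeMinus_eq (T : TrisectorFrame Si Sj Sk) :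
    planeMinus Si Sj Sk = endPlane Si T.wm T.end_wm.1 :=
  T.isPlaneAtInfinity_unique (Classical.epsilon_spec ⟨_, T.isPlaneAtInfinity_atBot⟩)
    T.isPlaneAtInfinity_atBot

theorem planeMinus_ne_planePlus (T : TrisectorFrame Si Sj Sk) :
    planeMinus Si Sj Sk ≠ planePlus Si Sj Sk := by
  rw [T.planeMinus_eq, T.planePlus_eq]
  intro h
  exact T.wm_ne_wp (neg_injective (congrArg OrientedPlane.normal h))

theorem commonTangentPlanes_eq (T : TrisectorFrame Si Sj Sk) :
    commonTangentPlanes Si Sj Sk = {planeMinus Si Sj Sk, planePlus Si Sj Sk} := by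
  ext Q
  rw [mem_commonTangentPlanes_iff, T.planeMinus_eq, T.planePlus_eq]
  constructor
  · rintro ⟨w, h, rfl⟩
    rcases T.eq_or_eq_of_isEndDirection h with rfl | rfl
    · exact Or.inl rfl
    · exact Or.inr rfl
  · rintro (rfl | rfl)
    · exact ⟨T.wm, T.end_wm, rfl⟩
    · exact ⟨T.wp, T.end_wp, rfl⟩

/-- The Distance predicate gives the signs of `excess` at the ends of the trisector, up to sign. -/
theorem distancePred_eq (T : TrisectorFrame Si Sj Sk) (S : Site) :
    distancePred Si Sj Sk S =
      (-SignType.sign (T.coefMinus S), -SignType.sign (T.coefPlus S)) := by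
  have h : SignType.sign (T.scale / 2) = 1 := sign_pos (by linarith [T.scale_pos])
  rw [distancePred, T.planeMinus_eq, T.planePlus_eq, siteDist_endPlane, siteDist_endPlane,
    Left.sign_neg, Left.sign_neg, coefMinus, coefPlus, sign_mul, sign_mul, h, one_mul, one_mul]

end TrisectorFrame

/-! ### The orientation of the tangency tetrahedron -/

/-- An equidistant point is not a center: the other site would be internally tangent. -/
theorem dist_pos_of_delta_eq {S T : Site} (h : 0 < gram S T T) {v : E3}
    (hv : S.delta v = T.delta v) : 0 < dist v S.center ∧ 0 < dist v T.center := by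
  have hg := abs_gap_lt_of_gram_pos h
  have e : ‖disp S T‖ = dist S.center T.center := by rw [dist_comm, disp, dist_eq_norm]
  rw [e, abs_lt] at hg
  unfold Site.delta at hv
  unfold gap at hg
  refine ⟨dist_pos.2 ?_, dist_pos.2 ?_⟩
  · rintro rfl
    rw [dist_self] at hv
    linarith
  · rintro rfl
    rw [dist_self, dist_comm] at hv
    linarith

/-- The determinant with the rows `(-x, t)`, `(c, a)`, `(d, b)`, `(e, g)`, as a linear form in
`(x, t)`. -/
noncomputable def minkowskiDet (c d e : E3) (a b g : ℝ) (x : E3) (t : ℝ) : ℝ :=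
  -t * inner ℝ e (cross c d) - a * inner ℝ x (cross d e) + b * inner ℝ x (cross c e) -
    g * inner ℝ x (cross c d)

/-- For a null vector `(w, 1)`, adding the multiples of the first three columns by the coordinates
of `w` to the last one empties the last column, up to one entry. -/
theorem minkowskiDet_of_null {w c d e : E3} {a b : ℝ} (g : ℝ) (h : inner ℝ w w = 1)
    (hc : inner ℝ w c = -a) (hd : inner ℝ w d = -b) :
    minkowskiDet c d e a b g w 1 = -(inner ℝ w e + g) * inner ℝ w (cross c d) := by
  have key : inner ℝ w w * inner ℝ e (cross c d) = inner ℝ w c * inner ℝ w (cross d e) -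
      inner ℝ w d * inner ℝ w (cross c e) + inner ℝ w e * inner ℝ w (cross c d) := by
    simp only [inner_coord, cross_zero, cross_one, cross_two]
    ring
  rw [h, hc, hd] at key
  rw [minkowskiDet]
  linear_combination -key

theorem tangencyDet_mul {Si Sj Sk Sa : Site} {v : E3} (hi : dist v Si.center ≠ 0)
    (hj : dist v Sj.center ≠ 0) (hk : dist v Sk.center ≠ 0) (ha : dist v Sa.center ≠ 0) :
    tangencyDet Si Sj Sk Sa v *
      (dist v Si.center * dist v Sj.center * dist v Sk.center * dist v Sa.center) =
    minkowskiDet (disp Si Sj) (disp Si Sk) (disp Si Sa) (dist v Sj.center - dist v Si.center)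
      (dist v Sk.center - dist v Si.center) (dist v Sa.center - dist v Si.center)
      (v - Si.center) (dist v Si.center) := by
  generalize hdi : dist v Si.center = ti at *
  generalize hdj : dist v Sj.center = tj at *
  generalize hdk : dist v Sk.center = tk at *
  generalize hda : dist v Sa.center = ta at *
  rw [tangencyDet, orientDet_eq_inner_cross]
  simp only [minkowskiDet, inner_coord, cross_zero, cross_one, cross_two, disp,
    contactPoint, hdi, hdj, hdk, hda, PiLp.sub_apply, PiLp.add_apply, PiLp.smul_apply, smul_eq_mul]
  field_simp
  ring

namespace TrisectorFrame
variable {Si Sj Sk : Site}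

/-- The orientation of the tetrahedron of the tangency points of an Apollonius sphere is opposite to
the sign of the derivative of `excess` along the trisector. -/
theorem sign_tangencyDet_point (T : TrisectorFrame Si Sj Sk) {S : Site} (hS : 0 < gram Si S S)
    {θ : ℝ} (h : Si.delta (T.point θ) = S.delta (T.point θ)) :
    SignType.sign (tangencyDet Si Sj Sk S (T.point θ)) =
      -SignType.sign (T.coefPlus S * Real.exp θ - T.coefMinus S * Real.exp (-θ)) := by
  have hj := dist_pos_of_delta_eq T.gram_j (T.point_mem θ).1
  have hk := dist_pos_of_delta_eq T.gram_k (T.point_mem θ).2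
  have ha := dist_pos_of_delta_eq hS h
  have e := tangencyDet_mul hj.1.ne' hj.2.ne' hk.2.ne' ha.2.ne'
  have gj : dist (T.point θ) Sj.center - dist (T.point θ) Si.center = gap Si Sj := by
    have := (T.point_mem θ).1
    unfold Site.delta at this
    unfold gap
    linarith
  have gk : dist (T.point θ) Sk.center - dist (T.point θ) Si.center = gap Si Sk := by
    have := (T.point_mem θ).2
    unfold Site.delta at this
    unfold gap
    linarith
  have ga : dist (T.point θ) S.center - dist (T.point θ) Si.center = gap Si S := by
    unfold Site.delta at h
    unfold gap
    linarith
  rw [gj, gk, ga, point_sub] at e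
  -- At the center of the hyperbola, the first row is a combination of the second and the third.
  have e0 : minkowskiDet (disp Si Sj) (disp Si Sk) (disp Si S) (gap Si Sj) (gap Si Sk) (gap Si S)
      (hub Si Sj Sk) (hubDist Si Sj Sk) = 0 := by
    simp only [minkowskiDet, hub, hubDist, inner_coord, cross_zero, cross_one, cross_two,
      PiLp.add_apply, PiLp.smul_apply, smul_eq_mul]
    ring
  have ep := minkowskiDet_of_null (e := disp Si S) (gap Si S) T.end_wp.1 T.end_wp.2.1 T.end_wp.2.2
  have em := minkowskiDet_of_null (e := disp Si S) (gap Si S) T.end_wm.1 T.end_wm.2.1 T.end_wm.2.2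
  have hm : inner ℝ T.wm (cross (disp Si Sj) (disp Si Sk)) = -T.height := T.wm_eq
  have hp : inner ℝ T.wp (cross (disp Si Sj) (disp Si Sk)) = T.height := rfl
  have key : minkowskiDet (disp Si Sj) (disp Si Sk) (disp Si S) (gap Si Sj) (gap Si Sk) (gap Si S)
      (T.offset θ) (dist (T.point θ) Si.center) =
      -(T.height * (T.coefPlus S * Real.exp θ - T.coefMinus S * Real.exp (-θ))) := by
    rw [dist_point, Real.cosh_eq, coefPlus, coefMinus]
    simp only [minkowskiDet, inner_offset, hm, hp] at e0 ep em ⊢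
    linear_combination e0 + T.scale / 2 * Real.exp θ * ep + T.scale / 2 * Real.exp (-θ) * em
  rw [key] at e
  have hpos : SignType.sign (dist (T.point θ) Si.center * dist (T.point θ) Sj.center *
      dist (T.point θ) Sk.center * dist (T.point θ) S.center) = 1 :=
    sign_pos (mul_pos (mul_pos (mul_pos hj.1 hj.2) hk.2) ha.2)
  have := congrArg SignType.sign e
  rwa [sign_mul, hpos, mul_one, Left.sign_neg, sign_mul, sign_pos T.height_pos, one_mul] at this

end TrisectorFrame

/-! ### Sign patterns of `A z + B + C z⁻¹` -/

/-- The positive set, the zeros of negative slope and the zeros of positive slope of a function are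
as in the shadow region of the given type: it is entered upwards and left downwards. -/
def ShadowProfile (pos down up : Set ℝ) : ShadowType → Prop
  | .empty => pos = ∅ ∧ down = ∅ ∧ up = ∅
  | .full => pos = Set.univ ∧ down = ∅ ∧ up = ∅
  | .left => ∃ φ, pos = Set.Iio φ ∧ down = {φ} ∧ up = ∅
  | .right => ∃ χ, pos = Set.Ioi χ ∧ down = ∅ ∧ up = {χ}
  | .middle => ∃ χ φ, χ < φ ∧ pos = Set.Ioo χ φ ∧ down = {φ} ∧ up = {χ}
  | .outer => ∃ φ χ, φ < χ ∧ pos = Set.Iio φ ∪ Set.Ioi χ ∧ down = {φ} ∧ up = {χ}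

/-- The Laurent polynomial `A z + B + C z⁻¹` at `z = exp θ`. -/
noncomputable def expSum (A B C θ : ℝ) : ℝ := A * Real.exp θ + B + C * Real.exp (-θ)

/-- The derivative of `expSum` with respect to `θ`. -/
noncomputable def expSlope (A C θ : ℝ) : ℝ := A * Real.exp θ - C * Real.exp (-θ)

theorem expSum_mul_exp (A B C θ : ℝ) :
    expSum A B C θ * Real.exp θ = A * Real.exp θ ^ 2 + B * Real.exp θ + C := by
  have e : Real.exp (-θ) * Real.exp θ = 1 := by rw [← Real.exp_add]; simp
  rw [expSum]
  linear_combination C * e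

theorem expSlope_mul_exp (A C θ : ℝ) :
    expSlope A C θ * Real.exp θ = A * Real.exp θ ^ 2 - C := by
  have e : Real.exp (-θ) * Real.exp θ = 1 := by rw [← Real.exp_add]; simp
  rw [expSlope]
  linear_combination -C * e

theorem expSum_neg (A B C θ : ℝ) : expSum (-A) (-B) (-C) θ = -expSum A B C θ := by
  simp only [expSum]
  ring

theorem expSlope_neg (A C θ : ℝ) : expSlope (-A) (-C) θ = -expSlope A C θ := by
  simp only [expSlope]
  ring

theorem exists_expSum_crossing {A C : ℝ} (B : ℝ) (hA : 0 < A) (hC : C < 0) :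
    ∃ χ, (∀ θ < χ, expSum A B C θ < 0) ∧ expSum A B C χ = 0 ∧ 0 < expSlope A C χ ∧
      ∀ θ > χ, 0 < expSum A B C θ := by
  have hmono : StrictMono (expSum A B C) := by
    intro x y hxy
    have h1 : Real.exp x < Real.exp y := Real.exp_lt_exp.2 hxy
    have h2 : Real.exp (-y) < Real.exp (-x) := Real.exp_lt_exp.2 (by linarith)
    simp only [expSum]
    nlinarith
  have hD : 0 ≤ B ^ 2 - 4 * A * C := by nlinarith [sq_nonneg B, mul_pos hA (neg_pos.2 hC)]
  have hr := Real.sq_sqrt hD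
  set r := √(B ^ 2 - 4 * A * C)
  have hrB : B < r := lt_of_abs_lt (abs_lt_of_sq_lt_sq (by nlinarith [mul_pos hA (neg_pos.2 hC)])
    (Real.sqrt_nonneg _))
  have hz : 0 < (-B + r) / (2 * A) := div_pos (by linarith) (by linarith)
  refine ⟨Real.log ((-B + r) / (2 * A)), ?_⟩
  set χ := Real.log ((-B + r) / (2 * A)) with hχ
  have hexp : Real.exp χ = (-B + r) / (2 * A) := Real.exp_log hz
  have h0 : expSum A B C χ = 0 := by
    have h := expSum_mul_exp A B C χ
    have h' : A * Real.exp χ ^ 2 + B * Real.exp χ + C = 0 := by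
      rw [hexp]
      field_simp
      linear_combination hr
    rw [h'] at h
    exact (mul_eq_zero.1 h).resolve_right (Real.exp_pos _).ne'
  refine ⟨fun θ h => h0 ▸ hmono h, h0, ?_, fun θ h => h0 ▸ hmono h⟩
  rw [expSlope]
  nlinarith [mul_pos hA (Real.exp_pos χ), mul_pos (neg_pos.2 hC) (Real.exp_pos (-χ))]

theorem expSum_pos_or_exists_crossings {A B C : ℝ} (hA : 0 < A) (hC : 0 < C)
    (hflat : ∀ θ, expSum A B C θ = 0 → expSlope A C θ ≠ 0) :
    (¬ (B < 0 ∧ 0 < B ^ 2 - 4 * A * C) ∧ ∀ θ, 0 < expSum A B C θ) ∨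
    ((B < 0 ∧ 0 < B ^ 2 - 4 * A * C) ∧ ∃ φ χ, φ < χ ∧ (∀ θ < φ, 0 < expSum A B C θ) ∧
      expSum A B C φ = 0 ∧ expSlope A C φ < 0 ∧ (∀ θ, φ < θ → θ < χ → expSum A B C θ < 0) ∧
      expSum A B C χ = 0 ∧ 0 < expSlope A C χ ∧ ∀ θ > χ, 0 < expSum A B C θ) := by
  by_cases hB : 0 ≤ B
  · refine Or.inl ⟨fun h => absurd h.1 (not_lt.2 hB), fun θ => ?_⟩
    rw [expSum]
    positivity
  have hB := not_le.1 hB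
  rcases lt_trichotomy (B ^ 2 - 4 * A * C) 0 with hD | hD | hD
  · refine Or.inl ⟨fun h => absurd h.2 hD.not_gt, fun θ => ?_⟩
    have h := expSum_mul_exp A B C θ
    have h1 : 0 < (expSum A B C θ * Real.exp θ) * (4 * A) := by
      rw [h]
      nlinarith [sq_nonneg (2 * A * Real.exp θ + B)]
    exact pos_of_mul_pos_left (pos_of_mul_pos_left h1 (by positivity)) (Real.exp_pos θ).le
  · -- A double zero would be a zero of slope `0`.
    exfalso
    have hz : 0 < -B / (2 * A) := div_pos (by linarith) (by linarith)
    have hexp : Real.exp (Real.log (-B / (2 * A))) = -B / (2 * A) := Real.exp_log hz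
    refine hflat (Real.log (-B / (2 * A))) ?_ ?_
    · refine (mul_eq_zero.1 ((expSum_mul_exp A B C _).trans ?_)).resolve_right (Real.exp_pos _).ne'
      rw [hexp]
      field_simp
      linear_combination -hD
    · refine (mul_eq_zero.1 ((expSlope_mul_exp A C _).trans ?_)).resolve_right (Real.exp_pos _).ne'
      rw [hexp]
      field_simp
      linear_combination hD
  · refine Or.inr ⟨⟨hB, hD⟩, ?_⟩
    have hr := Real.sq_sqrt hD.le
    have hr0 := Real.sqrt_pos.2 hD
    set r := √(B ^ 2 - 4 * A * C)
    have hrB : r < -B := by nlinarith [mul_pos hA hC]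
    have hz1 : 0 < (-B - r) / (2 * A) := div_pos (by linarith) (by linarith)
    have hz2 : 0 < (-B + r) / (2 * A) := div_pos (by linarith) (by linarith)
    have hlt : (-B - r) / (2 * A) < (-B + r) / (2 * A) :=
      div_lt_div_of_pos_right (by linarith) (by linarith)
    have e1 := Real.exp_log hz1
    have e2 := Real.exp_log hz2
    have hBe : B = -A * ((-B - r) / (2 * A) + (-B + r) / (2 * A)) := by
      field_simp
      ring
    have hCe : C = A * ((-B - r) / (2 * A) * ((-B + r) / (2 * A))) := by
      field_simp
      linear_combination hr
    set z₁ := (-B - r) / (2 * A)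
    set z₂ := (-B + r) / (2 * A)
    have key : ∀ θ, expSum A B C θ * Real.exp θ = A * ((Real.exp θ - z₁) * (Real.exp θ - z₂)) := by
      intro θ
      rw [expSum_mul_exp]
      linear_combination Real.exp θ * hBe + hCe
    have hpos : ∀ θ, 0 < (Real.exp θ - z₁) * (Real.exp θ - z₂) → 0 < expSum A B C θ := by
      intro θ h
      have := mul_pos hA h
      rw [← key] at this
      exact pos_of_mul_pos_left this (Real.exp_pos θ).le
    have hzero : ∀ θ, (Real.exp θ - z₁) * (Real.exp θ - z₂) = 0 → expSum A B C θ = 0 := by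
      intro θ h
      have := key θ
      rw [h, mul_zero] at this
      exact (mul_eq_zero.1 this).resolve_right (Real.exp_pos θ).ne'
    refine ⟨Real.log z₁, Real.log z₂, Real.log_lt_log hz1 hlt, ?_, ?_, ?_, ?_, ?_, ?_, ?_⟩
    · intro θ h
      have h1 := Real.exp_lt_exp.2 h
      rw [e1] at h1
      exact hpos θ (mul_pos_of_neg_of_neg (by linarith) (by linarith))
    · exact hzero _ (by rw [e1]; ring)
    · have h := expSlope_mul_exp A C (Real.log z₁)
      rw [e1] at h
      have h1 : A * z₁ ^ 2 - C < 0 := by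
        have h2 : A * z₁ ^ 2 - C = A * z₁ * (z₁ - z₂) := by linear_combination -hCe
        rw [h2]
        exact mul_neg_of_pos_of_neg (by positivity) (by linarith)
      rw [← h] at h1
      exact neg_of_mul_neg_left h1 hz1.le
    · intro θ h h'
      have h1 := Real.exp_lt_exp.2 h
      have h2 := Real.exp_lt_exp.2 h'
      rw [e1] at h1
      rw [e2] at h2
      have h3 : A * ((Real.exp θ - z₁) * (Real.exp θ - z₂)) < 0 :=
        mul_neg_of_pos_of_neg hA (mul_neg_of_pos_of_neg (by linarith) (by linarith))
      rw [← key] at h3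
      exact neg_of_mul_neg_left h3 (Real.exp_pos θ).le
    · exact hzero _ (by rw [e2]; ring)
    · have h := expSlope_mul_exp A C (Real.log z₂)
      rw [e2] at h
      have h1 : 0 < A * z₂ ^ 2 - C := by
        have h2 : A * z₂ ^ 2 - C = A * z₂ * (z₂ - z₁) := by linear_combination -hCe
        rw [h2]
        exact mul_pos (by positivity) (by linarith)
      rw [← h] at h1
      exact pos_of_mul_pos_left h1 hz2.le
    · intro θ h
      have h1 := Real.exp_lt_exp.2 h
      rw [e2] at h1
      exact hpos θ (mul_pos (by linarith) (by linarith))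

/-- The shadow type of `A z + B + C z⁻¹` from the signs of `A`, `C`, `B` and `B ^ 2 - 4 * A * C`. -/
def typeOfSigns (a c b d : SignType) : ShadowType :=
  if a = 1 then
    if c = 1 then if b = -1 ∧ d = 1 then .outer else .full else .right
  else
    if c = 1 then .left else if b = 1 ∧ d = 1 then .middle else .empty

theorem shadowProfile_expSum {A B C : ℝ} (hA : A ≠ 0) (hC : C ≠ 0)
    (hflat : ∀ θ, expSum A B C θ = 0 → expSlope A C θ ≠ 0) :
    ShadowProfile {θ | 0 < expSum A B C θ} {θ | expSum A B C θ = 0 ∧ expSlope A C θ < 0}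
      {θ | expSum A B C θ = 0 ∧ 0 < expSlope A C θ}
      (typeOfSigns (SignType.sign A) (SignType.sign C) (SignType.sign B)
        (SignType.sign (B ^ 2 - 4 * A * C))) := by
  rcases hA.lt_or_gt with hA | hA <;> rcases hC.lt_or_gt with hC | hC
  · have hflat' : ∀ θ, expSum (-A) (-B) (-C) θ = 0 → expSlope (-A) (-C) θ ≠ 0 := by
      intro θ h
      rw [expSum_neg, neg_eq_zero] at h
      rw [expSlope_neg]
      exact neg_ne_zero.2 (hflat θ h)
    have e : (-B) ^ 2 - 4 * -A * -C = B ^ 2 - 4 * A * C := by ring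
    have h := expSum_pos_or_exists_crossings (neg_pos.2 hA) (neg_pos.2 hC) hflat'
    simp only [expSum_neg, expSlope_neg, e, Left.neg_neg_iff, Left.neg_pos_iff, neg_eq_zero] at h
    rw [typeOfSigns, sign_neg hA, sign_neg hC, if_neg (by decide), if_neg (by decide)]
    have hs : SignType.sign B = 1 ∧ SignType.sign (B ^ 2 - 4 * A * C) = 1 ↔
        0 < B ∧ 0 < B ^ 2 - 4 * A * C := by rw [sign_eq_one_iff, sign_eq_one_iff]
    rcases h with ⟨h, h1⟩ | ⟨h, χ, φ, h0, h1, h2, h3, h4, h5, h6, h7⟩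
    · rw [if_neg (hs.not.2 h)]
      refine ⟨?_, ?_, ?_⟩ <;> grind
    · rw [if_pos (hs.2 h)]
      refine ⟨χ, φ, h0, ?_, ?_, ?_⟩ <;> grind
  · obtain ⟨φ, h1, h2, h3, h4⟩ := exists_expSum_crossing (-B) (neg_pos.2 hA) (neg_neg_iff_pos.2 hC)
    simp only [expSum_neg, expSlope_neg, Left.neg_neg_iff, Left.neg_pos_iff, neg_eq_zero]
      at h1 h2 h3 h4
    rw [typeOfSigns, sign_neg hA, sign_pos hC, if_neg (by decide), if_pos rfl]
    refine ⟨φ, ?_, ?_, ?_⟩ <;> grind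
  · obtain ⟨χ, h1, h2, h3, h4⟩ := exists_expSum_crossing B hA hC
    rw [typeOfSigns, sign_pos hA, sign_neg hC, if_pos rfl, if_neg (by decide)]
    refine ⟨χ, ?_, ?_, ?_⟩ <;> grind
  · rw [typeOfSigns, sign_pos hA, sign_pos hC, if_pos rfl, if_pos rfl]
    have hs : SignType.sign B = -1 ∧ SignType.sign (B ^ 2 - 4 * A * C) = 1 ↔
        B < 0 ∧ 0 < B ^ 2 - 4 * A * C := by rw [sign_eq_neg_one_iff, sign_eq_one_iff]
    rcases expSum_pos_or_exists_crossings hA hC hflat with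
      ⟨h, h1⟩ | ⟨h, φ, χ, h0, h1, h2, h3, h4, h5, h6, h7⟩
    · rw [if_neg (hs.not.2 h)]
      refine ⟨?_, ?_, ?_⟩ <;> grind
    · rw [if_pos (hs.2 h)]
      refine ⟨φ, χ, h0, ?_, ?_, ?_⟩ <;> grind

/-! ### The type of the shadow region -/

theorem HasShadowType.eq_empty_iff {A : Set ℝ} {t : ShadowType} (h : HasShadowType A t) :
    A = ∅ ↔ t = .empty := by
  cases t <;> simp only [HasShadowType] at h
  · simp [h]
  · simp [h]
  · obtain ⟨φ, rfl⟩ := h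
    simp
  · obtain ⟨χ, rfl⟩ := h
    simp
  · obtain ⟨χ, φ, hlt, rfl⟩ := h
    simpa using (Set.nonempty_Ioo.2 hlt).ne_empty
  · obtain ⟨φ, χ, hlt, rfl⟩ := h
    simp

theorem HasShadowType.eq_univ_iff {A : Set ℝ} {t : ShadowType} (h : HasShadowType A t) :
    A = Set.univ ↔ t = .full := by
  cases t <;> simp only [HasShadowType] at h
  · simp only [h, reduceCtorEq, iff_false]
    exact Set.empty_ne_univ
  · simp [h]
  · obtain ⟨φ, rfl⟩ := h
    simpa using fun h : Set.Iio φ = Set.univ =>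
      lt_irrefl φ (Set.eq_univ_iff_forall.1 h φ)
  · obtain ⟨χ, rfl⟩ := h
    simpa using fun h : Set.Ioi χ = Set.univ =>
      lt_irrefl χ (Set.eq_univ_iff_forall.1 h χ)
  · obtain ⟨χ, φ, hlt, rfl⟩ := h
    simpa using fun h => (Set.eq_univ_iff_forall.1 h φ).2.ne rfl
  · obtain ⟨φ, χ, hlt, rfl⟩ := h
    have : φ ∉ Set.Iio φ ∪ Set.Ioi χ := by simp [hlt.le]
    simpa using fun h => this (Set.eq_univ_iff_forall.1 h φ)

theorem HasShadowType.bddAbove_iff {A : Set ℝ} {t : ShadowType} (h : HasShadowType A t) :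
    BddAbove A ↔ t = .empty ∨ t = .left ∨ t = .middle := by
  cases t <;> simp only [HasShadowType] at h
  · simp [h]
  · simp [h]
  · obtain ⟨φ, rfl⟩ := h
    simp [bddAbove_Iio]
  · obtain ⟨χ, rfl⟩ := h
    simpa using not_bddAbove_Ioi χ
  · obtain ⟨χ, φ, hlt, rfl⟩ := h
    simp
  · obtain ⟨φ, χ, hlt, rfl⟩ := h
    simpa using fun h : BddAbove (Set.Iio φ ∪ Set.Ioi χ) =>
      not_bddAbove_Ioi χ (h.mono Set.subset_union_right)

theorem HasShadowType.bddBelow_iff {A : Set ℝ} {t : ShadowType} (h : HasShadowType A t) :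
    BddBelow A ↔ t = .empty ∨ t = .right ∨ t = .middle := by
  cases t <;> simp only [HasShadowType] at h
  · simp [h]
  · simp [h]
  · obtain ⟨φ, rfl⟩ := h
    simpa using not_bddBelow_Iio φ
  · obtain ⟨χ, rfl⟩ := h
    simp [bddBelow_Ioi]
  · obtain ⟨χ, φ, hlt, rfl⟩ := h
    simp
  · obtain ⟨φ, χ, hlt, rfl⟩ := h
    simpa using fun h : BddBelow (Set.Iio φ ∪ Set.Ioi χ) =>
      not_bddBelow_Iio φ (h.mono Set.subset_union_left)

/-- Emptiness, fullness and boundedness on either side tell the six types apart. -/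
theorem HasShadowType.unique {A : Set ℝ} {t t' : ShadowType} (h : HasShadowType A t)
    (h' : HasShadowType A t') : t = t' := by
  have h1 := h.eq_empty_iff.symm.trans h'.eq_empty_iff
  have h2 := h.eq_univ_iff.symm.trans h'.eq_univ_iff
  have h3 := h.bddAbove_iff.symm.trans h'.bddAbove_iff
  have h4 := h.bddBelow_iff.symm.trans h'.bddBelow_iff
  clear h h'
  cases t <;> cases t' <;> simp_all

theorem ShadowTable.unique {E : ℕ∞} {σ : SignType × SignType} {t t' : ShadowType}
    (h : ShadowTable E σ t) (h' : ShadowTable E σ t') : t = t' := by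
  cases h <;> cases h' <;> rfl

theorem ShadowProfile.hasShadowType {pos down up : Set ℝ} {t : ShadowType}
    (h : ShadowProfile pos down up t) (e : ℝ ≃o ℝ) : HasShadowType (e '' pos) t := by
  cases t <;> simp only [ShadowProfile] at h
  · simp [h.1, HasShadowType]
  · simp [h.1, HasShadowType]
  · obtain ⟨φ, rfl, -⟩ := h
    exact ⟨e φ, e.image_Iio φ⟩
  · obtain ⟨χ, rfl, -⟩ := h
    exact ⟨e χ, e.image_Ioi χ⟩
  · obtain ⟨χ, φ, hlt, rfl, -⟩ := h
    exact ⟨e χ, e φ, e.lt_iff_lt.2 hlt, e.image_Ioo χ φ⟩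
  · obtain ⟨φ, χ, hlt, rfl, -⟩ := h
    exact ⟨e φ, e χ, e.lt_iff_lt.2 hlt, by rw [Set.image_union, e.image_Iio, e.image_Ioi]⟩

theorem gram_pos_of_shadowInput {Si Sj Sk Sa : Site} (h : ShadowInput Si Sj Sk Sa) :
    0 < gram Si Sa Sa :=
  gram_self_pos (abs_gap_lt (h.not_contained 0 3 (by decide)) (h.not_contained 3 0 (by decide)))

namespace TrisectorFrame
variable {Si Sj Sk Sa : Site}

/-- `excess` along the trisector as a function of the hyperbolic angle. -/
noncomputable def trace (T : TrisectorFrame Si Sj Sk) (S : Site) (θ : ℝ) : ℝ :=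
  expSum (T.coefPlus S) (coefZero Si Sj Sk S) (T.coefMinus S) θ

/-- The derivative of `trace`. -/
noncomputable def slope (T : TrisectorFrame Si Sj Sk) (S : Site) (θ : ℝ) : ℝ :=
  expSlope (T.coefPlus S) (T.coefMinus S) θ

theorem point_injective (T : TrisectorFrame Si Sj Sk) : Function.Injective T.point :=
  fun _ _ h => T.strictMono_zeta_point.injective (congrArg (zeta Si Sj Sk) h)

theorem delta_point_eq_iff (T : TrisectorFrame Si Sj Sk) (hS : 0 < gram Si Sa Sa) (θ : ℝ) :
    Si.delta (T.point θ) = Sa.delta (T.point θ) ↔ T.trace Sa θ = 0 := by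
  rw [delta_eq_iff hS, excess_point, trace, expSum]

theorem point_mem_apolloniusVertices_iff (T : TrisectorFrame Si Sj Sk) (hS : 0 < gram Si Sa Sa)
    (θ : ℝ) : T.point θ ∈ apolloniusVertices Si Sj Sk Sa ↔ T.trace Sa θ = 0 := by
  rw [← T.delta_point_eq_iff hS]
  exact ⟨fun h => h.2.2, fun h => ⟨(T.point_mem θ).1, (T.point_mem θ).2, h⟩⟩

theorem sign_tangencyDet (T : TrisectorFrame Si Sj Sk) (hS : 0 < gram Si Sa Sa) {θ : ℝ}
    (h : T.trace Sa θ = 0) : SignType.sign (tangencyDet Si Sj Sk Sa (T.point θ)) =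
      -SignType.sign (T.slope Sa θ) :=
  T.sign_tangencyDet_point hS ((T.delta_point_eq_iff hS θ).2 h)

theorem verticesPos_eq (T : TrisectorFrame Si Sj Sk) (hS : 0 < gram Si Sa Sa) :
    verticesPos Si Sj Sk Sa = T.point '' {θ | T.trace Sa θ = 0 ∧ T.slope Sa θ < 0} := by
  have key : ∀ θ, T.point θ ∈ verticesPos Si Sj Sk Sa ↔ T.trace Sa θ = 0 ∧ T.slope Sa θ < 0 := by
    intro θ
    rw [verticesPos, Set.mem_ofPred_eq, T.point_mem_apolloniusVertices_iff hS]
    refine and_congr_right fun h => ?_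
    rw [← sign_eq_one_iff, T.sign_tangencyDet hS h, neg_eq_iff_eq_neg, sign_eq_neg_one_iff]
  ext v
  constructor
  · intro hv
    obtain ⟨θ, rfl⟩ := T.exists_point_eq (p := v) ⟨hv.1.1, hv.1.2.1⟩
    exact ⟨θ, (key θ).1 hv, rfl⟩
  · rintro ⟨θ, h, rfl⟩
    exact (key θ).2 h

theorem verticesNeg_eq (T : TrisectorFrame Si Sj Sk) (hS : 0 < gram Si Sa Sa) :
    verticesNeg Si Sj Sk Sa = T.point '' {θ | T.trace Sa θ = 0 ∧ 0 < T.slope Sa θ} := by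
  have key : ∀ θ, T.point θ ∈ verticesNeg Si Sj Sk Sa ↔ T.trace Sa θ = 0 ∧ 0 < T.slope Sa θ := by
    intro θ
    rw [verticesNeg, Set.mem_ofPred_eq, T.point_mem_apolloniusVertices_iff hS]
    refine and_congr_right fun h => ?_
    rw [← sign_eq_neg_one_iff, T.sign_tangencyDet hS h, neg_inj, sign_eq_one_iff]
  ext v
  constructor
  · intro hv
    obtain ⟨θ, rfl⟩ := T.exists_point_eq (p := v) ⟨hv.1.1, hv.1.2.1⟩
    exact ⟨θ, (key θ).1 hv, rfl⟩
  · rintro ⟨θ, h, rfl⟩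
    exact (key θ).2 h

theorem shadowImage_eq (T : TrisectorFrame Si Sj Sk) (hS : 0 < gram Si Sa Sa) :
    shadowImage Si Sj Sk Sa = T.zetaIso '' {θ | 0 < T.trace Sa θ} := by
  have key : ∀ θ, T.point θ ∈ shadowRegion Si Sj Sk Sa ↔ 0 < T.trace Sa θ := by
    intro θ
    rw [shadowRegion, Set.mem_ofPred_eq, deltaTangentSphere_lt_iff hS, excess_point, trace, expSum]
    exact and_iff_right (T.point_mem θ)
  ext y
  constructor
  · rintro ⟨v, hv, rfl⟩
    obtain ⟨θ, rfl⟩ := T.exists_point_eq hv.1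
    exact ⟨θ, (key θ).1 hv, rfl⟩
  · rintro ⟨θ, h, rfl⟩
    exact ⟨T.point θ, (key θ).2 h, rfl⟩

/-- The shadow type of `Sa` computed from the coefficients of `trace`. -/
noncomputable def shadowType (T : TrisectorFrame Si Sj Sk) (Sa : Site) : ShadowType :=
  typeOfSigns (SignType.sign (T.coefPlus Sa)) (SignType.sign (T.coefMinus Sa))
    (SignType.sign (coefZero Si Sj Sk Sa))
    (SignType.sign (coefZero Si Sj Sk Sa ^ 2 - 4 * T.coefPlus Sa * T.coefMinus Sa))

theorem coefPlus_ne_zero (T : TrisectorFrame Si Sj Sk) (h : ShadowInput Si Sj Sk Sa) :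
    T.coefPlus Sa ≠ 0 := by
  have h1 := h.distance_ne.2
  rw [T.distancePred_eq] at h1
  intro h0
  simp [h0] at h1

theorem coefMinus_ne_zero (T : TrisectorFrame Si Sj Sk) (h : ShadowInput Si Sj Sk Sa) :
    T.coefMinus Sa ≠ 0 := by
  have h1 := h.distance_ne.1
  rw [T.distancePred_eq] at h1
  intro h0
  simp [h0] at h1

theorem slope_ne_zero (T : TrisectorFrame Si Sj Sk) (h : ShadowInput Si Sj Sk Sa) (θ : ℝ)
    (h0 : T.trace Sa θ = 0) : T.slope Sa θ ≠ 0 := by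
  have hS := gram_pos_of_shadowInput h
  have h1 := h.not_flat _ ((T.point_mem_apolloniusVertices_iff hS θ).2 h0)
  have h2 := T.sign_tangencyDet hS h0
  intro h3
  rw [h3, sign_zero, neg_zero, sign_eq_zero_iff] at h2
  exact h1 h2

theorem shadowProfile (T : TrisectorFrame Si Sj Sk) (h : ShadowInput Si Sj Sk Sa) :
    ShadowProfile {θ | 0 < T.trace Sa θ} {θ | T.trace Sa θ = 0 ∧ T.slope Sa θ < 0}
      {θ | T.trace Sa θ = 0 ∧ 0 < T.slope Sa θ} (T.shadowType Sa) :=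
  shadowProfile_expSum (T.coefPlus_ne_zero h) (T.coefMinus_ne_zero h) (T.slope_ne_zero h)

theorem hasShadowType_shadowImage (T : TrisectorFrame Si Sj Sk) (h : ShadowInput Si Sj Sk Sa) :
    HasShadowType (shadowImage Si Sj Sk Sa) (T.shadowType Sa) := by
  rw [T.shadowImage_eq (gram_pos_of_shadowInput h)]
  exact (T.shadowProfile h).hasShadowType T.zetaIso

theorem existencePred_eq (T : TrisectorFrame Si Sj Sk) (h : ShadowInput Si Sj Sk Sa) :
    existencePred Si Sj Sk Sa = ({θ | T.trace Sa θ = 0 ∧ T.slope Sa θ < 0} ∪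
      {θ | T.trace Sa θ = 0 ∧ 0 < T.slope Sa θ}).encard := by
  have hS := gram_pos_of_shadowInput h
  have e : apolloniusVertices Si Sj Sk Sa =
      verticesPos Si Sj Sk Sa ∪ verticesNeg Si Sj Sk Sa := by
    ext v
    constructor
    · intro hv
      rcases (h.not_flat v hv).lt_or_gt with h1 | h1
      · exact Or.inr ⟨hv, h1⟩
      · exact Or.inl ⟨hv, h1⟩
    · rintro (hv | hv) <;> exact hv.1
  rw [existencePred, e, T.verticesPos_eq hS, T.verticesNeg_eq hS, ← Set.image_union,
    T.point_injective.encard_image]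

theorem shadowTable (T : TrisectorFrame Si Sj Sk) (h : ShadowInput Si Sj Sk Sa) :
    ShadowTable (existencePred Si Sj Sk Sa) (distancePred Si Sj Sk Sa) (T.shadowType Sa) := by
  have hp := T.shadowProfile h
  rw [T.existencePred_eq h, T.distancePred_eq]
  have h2 : ∀ {x y : ℝ}, x < y → ({x} ∪ {y} : Set ℝ).encard = 2 := fun hxy =>
    Set.encard_pair hxy.ne
  have h2' : ∀ {x y : ℝ}, x < y → ({y} ∪ {x} : Set ℝ).encard = 2 := fun hxy =>
    Set.encard_pair hxy.ne'
  unfold shadowType typeOfSigns at hp ⊢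
  rcases (T.coefPlus_ne_zero h).lt_or_gt with hA | hA <;>
  rcases (T.coefMinus_ne_zero h).lt_or_gt with hC | hC
  · rw [sign_neg hA, sign_neg hC, if_neg (by decide), if_neg (by decide)] at hp ⊢
    split_ifs at hp ⊢
    · obtain ⟨χ, φ, hlt, -, h3, h4⟩ := hp
      rw [h3, h4, h2' hlt, neg_neg]
      exact .middle
    · rw [hp.2.1, hp.2.2, Set.union_empty, Set.encard_empty, neg_neg]
      exact .empty
  · rw [sign_neg hA, sign_pos hC, if_neg (by decide), if_pos rfl] at hp ⊢
    obtain ⟨φ, -, h3, h4⟩ := hp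
    rw [h3, h4, Set.union_empty, Set.encard_singleton, neg_neg]
    exact .left
  · rw [sign_pos hA, sign_neg hC, if_pos rfl, if_neg (by decide)] at hp ⊢
    obtain ⟨χ, -, h3, h4⟩ := hp
    rw [h3, h4, Set.empty_union, Set.encard_singleton, neg_neg]
    exact .right
  · rw [sign_pos hA, sign_pos hC, if_pos rfl, if_pos rfl] at hp ⊢
    split_ifs at hp ⊢
    · obtain ⟨φ, χ, hlt, -, h3, h4⟩ := hp
      rw [h3, h4, h2 hlt]
      exact .outer
    · rw [hp.2.1, hp.2.2, Set.union_empty, Set.encard_empty]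
      exact .full

theorem hasShadowType_iff (T : TrisectorFrame Si Sj Sk) (h : ShadowInput Si Sj Sk Sa)
    (t : ShadowType) : HasShadowType (shadowImage Si Sj Sk Sa) t ↔ t = T.shadowType Sa := by
  constructor
  · intro ht
    exact ht.unique (T.hasShadowType_shadowImage h)
  · rintro rfl
    exact T.hasShadowType_shadowImage h

theorem vertices_of_shadowImage_eq_Iio (T : TrisectorFrame Si Sj Sk)
    (h : ShadowInput Si Sj Sk Sa) {φ : ℝ} (hφ : shadowImage Si Sj Sk Sa = Set.Iio φ) :
    ∃ v, verticesPos Si Sj Sk Sa = {v} ∧ verticesNeg Si Sj Sk Sa = ∅ ∧ zeta Si Sj Sk v = φ := by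
  have hS := gram_pos_of_shadowInput h
  have hp := T.shadowProfile h
  rw [← (T.hasShadowType_iff h .left).1 ⟨φ, hφ⟩] at hp
  obtain ⟨θ, h1, h2, h3⟩ := hp
  rw [T.shadowImage_eq hS, h1, OrderIso.image_Iio] at hφ
  refine ⟨T.point θ, ?_, ?_, Set.Iio_injective hφ⟩
  · rw [T.verticesPos_eq hS, h2, Set.image_singleton]
  · rw [T.verticesNeg_eq hS, h3, Set.image_empty]

theorem vertices_of_shadowImage_eq_Ioi (T : TrisectorFrame Si Sj Sk)
    (h : ShadowInput Si Sj Sk Sa) {χ : ℝ} (hχ : shadowImage Si Sj Sk Sa = Set.Ioi χ) :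
    ∃ w, verticesNeg Si Sj Sk Sa = {w} ∧ verticesPos Si Sj Sk Sa = ∅ ∧ zeta Si Sj Sk w = χ := by
  have hS := gram_pos_of_shadowInput h
  have hp := T.shadowProfile h
  rw [← (T.hasShadowType_iff h .right).1 ⟨χ, hχ⟩] at hp
  obtain ⟨θ, h1, h2, h3⟩ := hp
  rw [T.shadowImage_eq hS, h1, OrderIso.image_Ioi] at hχ
  refine ⟨T.point θ, ?_, ?_, Set.Ioi_injective hχ⟩
  · rw [T.verticesNeg_eq hS, h3, Set.image_singleton]
  · rw [T.verticesPos_eq hS, h2, Set.image_empty]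

theorem vertices_of_shadowImage_eq_Ioo (T : TrisectorFrame Si Sj Sk)
    (h : ShadowInput Si Sj Sk Sa) {χ φ : ℝ} (hlt : χ < φ)
    (he : shadowImage Si Sj Sk Sa = Set.Ioo χ φ) :
    ∃ w v, verticesNeg Si Sj Sk Sa = {w} ∧ verticesPos Si Sj Sk Sa = {v} ∧
      zeta Si Sj Sk w = χ ∧ zeta Si Sj Sk v = φ := by
  have hS := gram_pos_of_shadowInput h
  have hp := T.shadowProfile h
  rw [← (T.hasShadowType_iff h .middle).1 ⟨χ, φ, hlt, he⟩] at hp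
  obtain ⟨θ, θ', hlt', h1, h2, h3⟩ := hp
  rw [T.shadowImage_eq hS, h1, OrderIso.image_Ioo] at he
  have hlt' : T.zetaIso θ < T.zetaIso θ' := T.zetaIso.lt_iff_lt.2 hlt'
  refine ⟨T.point θ, T.point θ', ?_, ?_, ?_, ?_⟩
  · rw [T.verticesNeg_eq hS, h3, Set.image_singleton]
  · rw [T.verticesPos_eq hS, h2, Set.image_singleton]
  · rw [← T.zetaIso_apply, ← csInf_Ioo hlt', he, csInf_Ioo hlt]
  · rw [← T.zetaIso_apply, ← csSup_Ioo hlt', he, csSup_Ioo hlt]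

theorem vertices_of_shadowImage_eq_union (T : TrisectorFrame Si Sj Sk)
    (h : ShadowInput Si Sj Sk Sa) {φ χ : ℝ} (hlt : φ < χ)
    (he : shadowImage Si Sj Sk Sa = Set.Iio φ ∪ Set.Ioi χ) :
    ∃ w v, verticesNeg Si Sj Sk Sa = {w} ∧ verticesPos Si Sj Sk Sa = {v} ∧
      zeta Si Sj Sk w = χ ∧ zeta Si Sj Sk v = φ := by
  have hS := gram_pos_of_shadowInput h
  have hp := T.shadowProfile h
  rw [← (T.hasShadowType_iff h .outer).1 ⟨φ, χ, hlt, he⟩] at hp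
  obtain ⟨θ, θ', hlt', h1, h2, h3⟩ := hp
  rw [T.shadowImage_eq hS, h1, Set.image_union, OrderIso.image_Iio, OrderIso.image_Ioi] at he
  have hlt' : T.zetaIso θ < T.zetaIso θ' := T.zetaIso.lt_iff_lt.2 hlt'
  have hc : Set.Icc (T.zetaIso θ) (T.zetaIso θ') = Set.Icc φ χ := by
    have := congrArg compl he
    rwa [Set.compl_union, Set.compl_union, Set.compl_Iio, Set.compl_Iio, Set.compl_Ioi,
      Set.compl_Ioi, Set.Ici_inter_Iic, Set.Ici_inter_Iic] at this
  refine ⟨T.point θ', T.point θ, ?_, ?_, ?_, ?_⟩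
  · rw [T.verticesNeg_eq hS, h3, Set.image_singleton]
  · rw [T.verticesPos_eq hS, h2, Set.image_singleton]
  · rw [← T.zetaIso_apply, ← csSup_Icc hlt'.le, hc, csSup_Icc hlt.le]
  · rw [← T.zetaIso_apply, ← csInf_Icc hlt'.le, hc, csInf_Icc hlt.le]

end TrisectorFrame

/-! ### Polynomials deciding the type -/

section InputForms
variable {R : Type*} [CommRing R]

/-- The Euclidean product of the `m`-th and the `n`-th center, relative to the first one. -/
def dotForm (q : Fin 4 × Fin 4 → R) (m n : Fin 4) : R :=
  (q (m, 0) - q (0, 0)) * (q (n, 0) - q (0, 0)) + (q (m, 1) - q (0, 1)) * (q (n, 1) - q (0, 1)) +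
    (q (m, 2) - q (0, 2)) * (q (n, 2) - q (0, 2))

/-- The `m`-th radius, relative to the first one. -/
def gapForm (q : Fin 4 × Fin 4 → R) (m : Fin 4) : R := q (m, 3) - q (0, 3)

/-- The Lorentzian product of the `m`-th and the `n`-th site, relative to the first one. -/
def gramForm (q : Fin 4 × Fin 4 → R) (m n : Fin 4) : R :=
  dotForm q m n - gapForm q m * gapForm q n

/-- The mean of the values of `(w, -1)` at `Sa - Si` for the two end directions `w`, times
`normalSq`; its degree is `5`. -/
def meanForm (q : Fin 4 × Fin 4 → R) : R :=
  (dotForm q 1 1 * dotForm q 2 2 - dotForm q 1 2 * dotForm q 1 2) * gapForm q 3 -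
    (gapForm q 1 * (dotForm q 1 3 * dotForm q 2 2 - dotForm q 2 3 * dotForm q 1 2) +
      gapForm q 2 * (dotForm q 2 3 * dotForm q 1 1 - dotForm q 1 3 * dotForm q 1 2))

/-- The triple product of the centers, relative to the first one; its degree is `3`. -/
def tripleForm (q : Fin 4 × Fin 4 → R) : R :=
  (q (3, 0) - q (0, 0)) * ((q (1, 1) - q (0, 1)) * (q (2, 2) - q (0, 2)) -
      (q (1, 2) - q (0, 2)) * (q (2, 1) - q (0, 1))) +
    (q (3, 1) - q (0, 1)) * ((q (1, 2) - q (0, 2)) * (q (2, 0) - q (0, 0)) -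
      (q (1, 0) - q (0, 0)) * (q (2, 2) - q (0, 2))) +
    (q (3, 2) - q (0, 2)) * ((q (1, 0) - q (0, 0)) * (q (2, 1) - q (0, 1)) -
      (q (1, 1) - q (0, 1)) * (q (2, 0) - q (0, 0)))

/-- The minor of the Lorentzian Gram matrix of the sites with the rows `m`, `n` and the columns
`m'`, `n'`. -/
def cofactorForm (q : Fin 4 × Fin 4 → R) (m n m' n' : Fin 4) : R :=
  gramForm q m m' * gramForm q n n' - gramForm q m n' * gramForm q n m'

/-- The Lorentzian Gram determinant of the three sites other than the first one; its degree is `6`.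
-/
def gramDetForm (q : Fin 4 × Fin 4 → R) : R :=
  gramForm q 1 3 * cofactorForm q 1 2 2 3 - gramForm q 2 3 * cofactorForm q 1 2 1 3 +
    gramForm q 3 3 * cofactorForm q 1 2 1 2

/-- The value of `excess` at the center of the hyperbola, times `2 * gramDet`; its degree is `6`. -/
def zeroForm (q : Fin 4 × Fin 4 → R) : R :=
  gramForm q 2 2 * (gramForm q 1 1 - gramForm q 1 2) * gramForm q 1 3 +
    gramForm q 1 1 * (gramForm q 2 2 - gramForm q 1 2) * gramForm q 2 3 -
    gramForm q 3 3 * cofactorForm q 1 2 1 2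

/-- Minus the determinant of the Lorentzian Gram matrix bordered by its diagonal; its degree is `8`.
-/
def borderedForm (q : Fin 4 × Fin 4 → R) : R :=
  gramForm q 1 1 * gramForm q 1 1 * cofactorForm q 2 3 2 3 +
    gramForm q 2 2 * gramForm q 2 2 * cofactorForm q 1 3 1 3 +
    gramForm q 3 3 * gramForm q 3 3 * cofactorForm q 1 2 1 2 -
    2 * (gramForm q 1 1 * gramForm q 2 2 * cofactorForm q 1 3 2 3) +
    2 * (gramForm q 1 1 * gramForm q 3 3 * cofactorForm q 1 2 2 3) -
    2 * (gramForm q 2 2 * gramForm q 3 3 * cofactorForm q 1 2 1 3)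

/-- The forms whose signs determine the shadow type. -/
def shadowForm (q : Fin 4 × Fin 4 → R) : Fin 5 → R :=
  ![meanForm q, tripleForm q, gramDetForm q, zeroForm q, borderedForm q]

end InputForms

/-- The polynomials whose signs determine the shadow type. -/
noncomputable def shadowPolynomial : Fin 5 → MvPolynomial (Fin 4 × Fin 4) ℤ :=
  shadowForm MvPolynomial.X

theorem aeval_shadowPolynomial (v : Fin 4 × Fin 4 → ℝ) (n : Fin 5) :
    MvPolynomial.aeval v (shadowPolynomial n) = shadowForm v n := by
  fin_cases n <;>
    simp [shadowPolynomial, shadowForm, meanForm, tripleForm, gramDetForm, zeroForm, borderedForm,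
      cofactorForm, gramForm, gapForm, dotForm]

section Degree
variable {p q : MvPolynomial (Fin 4 × Fin 4) ℤ} {k l m : ℕ}

theorem totalDegree_mul_le (hp : p.totalDegree ≤ k) (hq : q.totalDegree ≤ l) (h : k + l ≤ m) :
    (p * q).totalDegree ≤ m :=
  (MvPolynomial.totalDegree_mul p q).trans ((add_le_add hp hq).trans h)

theorem totalDegree_add_le (hp : p.totalDegree ≤ m) (hq : q.totalDegree ≤ m) :
    (p + q).totalDegree ≤ m :=
  (MvPolynomial.totalDegree_add p q).trans (max_le hp hq)

theorem totalDegree_sub_le (hp : p.totalDegree ≤ m) (hq : q.totalDegree ≤ m) :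
    (p - q).totalDegree ≤ m :=
  (MvPolynomial.totalDegree_sub p q).trans (max_le hp hq)

theorem totalDegree_two_mul_le (hp : p.totalDegree ≤ m) : (2 * p).totalDegree ≤ m := by
  rw [two_mul]
  exact totalDegree_add_le hp hp

theorem totalDegree_X_sub_X_le (i j : Fin 4 × Fin 4) :
    (MvPolynomial.X i - MvPolynomial.X j : MvPolynomial (Fin 4 × Fin 4) ℤ).totalDegree ≤ 1 :=
  totalDegree_sub_le (MvPolynomial.totalDegree_X i).le (MvPolynomial.totalDegree_X j).le

theorem totalDegree_gapForm_le (i : Fin 4) :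
    (gapForm (MvPolynomial.X (R := ℤ)) i).totalDegree ≤ 1 :=
  totalDegree_X_sub_X_le _ _

theorem totalDegree_dotForm_le (i j : Fin 4) :
    (dotForm (MvPolynomial.X (R := ℤ)) i j).totalDegree ≤ 2 := by
  have h := fun i j k l => totalDegree_mul_le (totalDegree_X_sub_X_le i j)
    (totalDegree_X_sub_X_le k l) le_rfl
  exact totalDegree_add_le (totalDegree_add_le (h _ _ _ _) (h _ _ _ _)) (h _ _ _ _)

theorem totalDegree_gramForm_le (i j : Fin 4) :
    (gramForm (MvPolynomial.X (R := ℤ)) i j).totalDegree ≤ 2 :=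
  totalDegree_sub_le (totalDegree_dotForm_le i j)
    (totalDegree_mul_le (totalDegree_gapForm_le i) (totalDegree_gapForm_le j) le_rfl)

theorem totalDegree_cofactorForm_le (i j i' j' : Fin 4) :
    (cofactorForm (MvPolynomial.X (R := ℤ)) i j i' j').totalDegree ≤ 4 := by
  have h := fun i j k l => totalDegree_mul_le (totalDegree_gramForm_le i j)
    (totalDegree_gramForm_le k l) (m := 4) le_rfl
  exact totalDegree_sub_le (h _ _ _ _) (h _ _ _ _)

theorem totalDegree_shadowPolynomial_le (n : Fin 5) : (shadowPolynomial n).totalDegree ≤ 8 := by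
  have hX := totalDegree_X_sub_X_le
  have hd := totalDegree_dotForm_le
  have ha := totalDegree_gapForm_le
  have hg := totalDegree_gramForm_le
  have hc := totalDegree_cofactorForm_le
  have hdd := fun i j k l => totalDegree_mul_le (hd i j) (hd k l) (m := 4) le_rfl
  have hXX := fun i j k l => totalDegree_mul_le (hX i j) (hX k l) (m := 2) le_rfl
  have hgc := fun i j a b c d => totalDegree_mul_le (hg i j) (hc a b c d) (m := 8) (by norm_num)
  have hggc := fun i j k l a b c d => totalDegree_mul_le
    (totalDegree_mul_le (hg i j) (hg k l) (m := 4) le_rfl) (hc a b c d) (m := 8) le_rfl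
  have hggg := fun i j k l k' l' a b => totalDegree_mul_le (totalDegree_mul_le (hg i j)
    (totalDegree_sub_le (hg k l) (hg k' l')) (m := 4) le_rfl) (hg a b) (m := 8) (by norm_num)
  fin_cases n
  · have hadd := fun i a b c d a' b' c' d' => totalDegree_mul_le (ha i)
      (totalDegree_sub_le (hdd a b c d) (hdd a' b' c' d')) (m := 8) (by norm_num)
    have hdda := fun i a b c d a' b' c' d' => totalDegree_mul_le
      (totalDegree_sub_le (hdd a b c d) (hdd a' b' c' d')) (ha i) (m := 8) (by norm_num)
    exact totalDegree_sub_le (hdda _ _ _ _ _ _ _ _ _)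
      (totalDegree_add_le (hadd _ _ _ _ _ _ _ _ _) (hadd _ _ _ _ _ _ _ _ _))
  · have h := fun i j a b c d a' b' c' d' => totalDegree_mul_le (hX i j)
      (totalDegree_sub_le (hXX a b c d) (hXX a' b' c' d')) (m := 8) (by norm_num)
    exact totalDegree_add_le (totalDegree_add_le (h _ _ _ _ _ _ _ _ _ _) (h _ _ _ _ _ _ _ _ _ _))
      (h _ _ _ _ _ _ _ _ _ _)
  · exact totalDegree_add_le (totalDegree_sub_le (hgc _ _ _ _ _ _) (hgc _ _ _ _ _ _))
      (hgc _ _ _ _ _ _)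
  · exact totalDegree_sub_le (totalDegree_add_le (hggg _ _ _ _ _ _ _ _) (hggg _ _ _ _ _ _ _ _))
      (hgc _ _ _ _ _ _)
  · have h := hggc
    have h2 := fun i j k l a b c d => totalDegree_two_mul_le (h i j k l a b c d)
    exact totalDegree_sub_le (totalDegree_add_le (totalDegree_sub_le (totalDegree_add_le
      (totalDegree_add_le (h _ _ _ _ _ _ _ _) (h _ _ _ _ _ _ _ _)) (h _ _ _ _ _ _ _ _))
      (h2 _ _ _ _ _ _ _ _)) (h2 _ _ _ _ _ _ _ _)) (h2 _ _ _ _ _ _ _ _)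

end Degree

section Evaluation
variable (Si Sj Sk Sa : Site)

theorem dotForm_inputQuantities (m n : Fin 4) :
    dotForm (inputQuantities Si Sj Sk Sa) m n =
      inner ℝ (disp Si (![Si, Sj, Sk, Sa] m)) (disp Si (![Si, Sj, Sk, Sa] n)) := by
  simp [dotForm, inputQuantities, inner_coord, disp]

theorem gapForm_inputQuantities (m : Fin 4) :
    gapForm (inputQuantities Si Sj Sk Sa) m = gap Si (![Si, Sj, Sk, Sa] m) := by
  simp [gapForm, inputQuantities, gap]

theorem gramForm_inputQuantities (m n : Fin 4) :
    gramForm (inputQuantities Si Sj Sk Sa) m n =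
      gram Si (![Si, Sj, Sk, Sa] m) (![Si, Sj, Sk, Sa] n) := by
  rw [gramForm, dotForm_inputQuantities, gapForm_inputQuantities, gapForm_inputQuantities, gram]

theorem cofactorForm_inputQuantities :
    cofactorForm (inputQuantities Si Sj Sk Sa) 1 2 1 2 = gramDet Si Sj Sk := by
  rw [cofactorForm, gramForm_inputQuantities, gramForm_inputQuantities, gramForm_inputQuantities,
    gramForm_inputQuantities, gramDet]
  simp only [Matrix.cons_val]
  rw [gram_comm Si Sk Sj]
  ring

theorem tripleForm_inputQuantities :
    tripleForm (inputQuantities Si Sj Sk Sa) = inner ℝ (disp Si Sa) (normal Si Sj Sk) := by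
  simp [tripleForm, inputQuantities, inner_coord, disp, normal, cross_zero, cross_one, cross_two]

theorem sq_inner_normal : inner ℝ (disp Si Sa) (normal Si Sj Sk) ^ 2 =
    inner ℝ (disp Si Sj) (disp Si Sj) * inner ℝ (disp Si Sk) (disp Si Sk) *
        inner ℝ (disp Si Sa) (disp Si Sa) +
      2 * inner ℝ (disp Si Sj) (disp Si Sk) * inner ℝ (disp Si Sj) (disp Si Sa) *
        inner ℝ (disp Si Sk) (disp Si Sa) -
      inner ℝ (disp Si Sj) (disp Si Sj) * inner ℝ (disp Si Sk) (disp Si Sa) ^ 2 -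
      inner ℝ (disp Si Sk) (disp Si Sk) * inner ℝ (disp Si Sj) (disp Si Sa) ^ 2 -
      inner ℝ (disp Si Sa) (disp Si Sa) * inner ℝ (disp Si Sj) (disp Si Sk) ^ 2 := by
  simp only [normal, inner_coord, cross_zero, cross_one, cross_two]
  ring

end Evaluation

namespace TrisectorFrame
variable {Si Sj Sk : Site}

theorem normalSq_mul_end {w : E3} (hw : IsEndDirection Si Sj Sk w) (Sa : Site) :
    normalSq Si Sj Sk * (inner ℝ w (disp Si Sa) + gap Si Sa) =
      meanForm (inputQuantities Si Sj Sk Sa) +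
        inner ℝ w (normal Si Sj Sk) * tripleForm (inputQuantities Si Sj Sk Sa) := by
  have h := congrArg (inner ℝ w) (cross_decomposition (disp Si Sj) (disp Si Sk) (disp Si Sa))
  change inner ℝ w (normalSq Si Sj Sk • disp Si Sa) =
    inner ℝ w (_ + _ + inner ℝ (disp Si Sa) (normal Si Sj Sk) • normal Si Sj Sk) at h
  simp only [inner_add_right, inner_smul_right, hw.2.1, hw.2.2] at h
  rw [tripleForm_inputQuantities, meanForm, mul_add, h]
  simp only [dotForm_inputQuantities, gapForm_inputQuantities, Matrix.cons_val, normalSq_eq,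
    real_inner_comm (disp Si Sa)]
  ring

theorem normalSq_mul_wp (T : TrisectorFrame Si Sj Sk) (Sa : Site) :
    normalSq Si Sj Sk * (inner ℝ T.wp (disp Si Sa) + gap Si Sa) =
      meanForm (inputQuantities Si Sj Sk Sa) +
        T.height * tripleForm (inputQuantities Si Sj Sk Sa) :=
  normalSq_mul_end T.end_wp Sa

theorem normalSq_mul_wm (T : TrisectorFrame Si Sj Sk) (Sa : Site) :
    normalSq Si Sj Sk * (inner ℝ T.wm (disp Si Sa) + gap Si Sa) =
      meanForm (inputQuantities Si Sj Sk Sa) -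
        T.height * tripleForm (inputQuantities Si Sj Sk Sa) := by
  rw [normalSq_mul_end T.end_wm, T.wm_eq, height]
  ring

/-- The product of the values at the two ends is the Lorentzian Gram determinant of the three sites,
up to a negative factor. -/
theorem wp_mul_wm (T : TrisectorFrame Si Sj Sk) (Sa : Site) :
    normalSq Si Sj Sk * ((inner ℝ T.wp (disp Si Sa) + gap Si Sa) *
      (inner ℝ T.wm (disp Si Sa) + gap Si Sa)) = -gramDetForm (inputQuantities Si Sj Sk Sa) := by
  have hp := T.normalSq_mul_wp Sa
  have hm := T.normalSq_mul_wm Sa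
  have hq := sq_inner_normal Si Sj Sk Sa
  have hH := T.height_sq
  rw [← tripleForm_inputQuantities] at hq
  have key : meanForm (inputQuantities Si Sj Sk Sa) ^ 2 -
      gramDet Si Sj Sk * tripleForm (inputQuantities Si Sj Sk Sa) ^ 2 =
      normalSq Si Sj Sk * -gramDetForm (inputQuantities Si Sj Sk Sa) := by
    rw [hq]
    simp only [meanForm, gramDetForm, cofactorForm, gramDet, gramForm, gram,
      dotForm_inputQuantities, gapForm_inputQuantities, Matrix.cons_val, normalSq_eq,
      real_inner_comm (disp Si Sj)]
    ring
  refine mul_left_cancel₀ T.normalSq_pos.ne' ?_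
  rw [← key, ← hH]
  generalize inner ℝ T.wp (disp Si Sa) + gap Si Sa = x at *
  generalize inner ℝ T.wm (disp Si Sa) + gap Si Sa = y at *
  linear_combination normalSq Si Sj Sk * y * hp + (meanForm (inputQuantities Si Sj Sk Sa) +
    T.height * tripleForm (inputQuantities Si Sj Sk Sa)) * hm

theorem coefZero_eq (T : TrisectorFrame Si Sj Sk) (Sa : Site) :
    2 * gramDet Si Sj Sk * coefZero Si Sj Sk Sa =
      zeroForm (inputQuantities Si Sj Sk Sa) := by
  have := T.gramDet_pos
  rw [zeroForm, cofactorForm_inputQuantities, coefZero, coefJ, coefK]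
  simp only [gramForm_inputQuantities, Matrix.cons_val]
  field_simp

/-- Sylvester's identity makes the discriminant of `trace` a polynomial of degree `8`, up to a
positive factor. -/
theorem discrim_eq (T : TrisectorFrame Si Sj Sk) (Sa : Site) :
    4 * gramDet Si Sj Sk *
      (coefZero Si Sj Sk Sa ^ 2 - 4 * T.coefPlus Sa * T.coefMinus Sa) =
      borderedForm (inputQuantities Si Sj Sk Sa) := by
  have hW := T.gramDet_pos
  have hG := T.normalSq_pos
  have h0 := T.coefZero_eq Sa
  have hs := T.scale_sq
  rw [T.height_sq] at hs
  have hpm := T.wp_mul_wm Sa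
  have hK : 4 * gramDet Si Sj Sk * hubSq Si Sj Sk =
      gram Si Sj Sj * gram Si Sk Sk * (gram Si Sj Sj - 2 * gram Si Sj Sk + gram Si Sk Sk) := by
    rw [← gram_polarization, hubSq]
    field_simp
  have h1 : gramDet Si Sj Sk * (4 * T.coefPlus Sa * T.coefMinus Sa) =
      -(hubSq Si Sj Sk * gramDetForm (inputQuantities Si Sj Sk Sa)) := by
    rw [coefPlus, coefMinus]
    linear_combination ((inner ℝ T.wp (disp Si Sa) + gap Si Sa) *
      (inner ℝ T.wm (disp Si Sa) + gap Si Sa)) * hs + hubSq Si Sj Sk * hpm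
  have key : zeroForm (inputQuantities Si Sj Sk Sa) ^ 2 + gram Si Sj Sj * gram Si Sk Sk *
      (gram Si Sj Sj - 2 * gram Si Sj Sk + gram Si Sk Sk) *
        gramDetForm (inputQuantities Si Sj Sk Sa) =
      gramDet Si Sj Sk * borderedForm (inputQuantities Si Sj Sk Sa) := by
    simp only [zeroForm, gramDetForm, borderedForm, cofactorForm, gramForm_inputQuantities,
      Matrix.cons_val, gramDet, gram_comm Si Sk Sj, gram_comm Si Sa Sj, gram_comm Si Sa Sk]
    ring
  refine mul_left_cancel₀ hW.ne' ?_
  rw [← key, ← h0, ← hK]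
  linear_combination -4 * gramDet Si Sj Sk * h1

end TrisectorFrame

/-- The shadow type from the signs of the forms `shadowForm`. The Gram determinant is negative iff
both ends of the trisector have the same sign. -/
def typeOfForms (s : Fin 5 → SignType) : ShadowType :=
  typeOfSigns (if s 2 = -1 then s 0 else s 1) (if s 2 = -1 then s 0 else -s 1) (s 3) (s 4)

/-- The signs of two numbers from those of their sum, their difference and their product. -/
theorem sign_eq_of_add_of_sub_of_mul {x y m d p : ℝ} (hx : x ≠ 0) (hy : y ≠ 0)
    (hm : SignType.sign (x + y) = SignType.sign m) (hd : SignType.sign (x - y) = SignType.sign d)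
    (hp : SignType.sign (x * y) = -SignType.sign p) :
    SignType.sign x = (if SignType.sign p = -1 then SignType.sign m else SignType.sign d) ∧
    SignType.sign y = (if SignType.sign p = -1 then SignType.sign m else -SignType.sign d) := by
  rw [← hm, ← hd, ← neg_eq_iff_eq_neg.2 hp, sign_mul]
  rcases hx.lt_or_gt with hx | hx <;> rcases hy.lt_or_gt with hy | hy
  · rw [sign_neg hx, sign_neg hy, sign_neg (add_neg hx hy)]
    generalize SignType.sign (x - y) = s
    revert s
    decide
  · rw [sign_neg hx, sign_pos hy, sign_neg (sub_neg.2 (hx.trans hy))]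
    simp
  · rw [sign_pos hx, sign_neg hy, sign_pos (sub_pos.2 (hy.trans hx))]
    simp
  · rw [sign_pos hx, sign_pos hy, sign_pos (add_pos hx hy)]
    generalize SignType.sign (x - y) = s
    revert s
    decide

theorem sign_eq_of_mul_eq {k x y : ℝ} (hk : 0 < k) (h : k * x = y) :
    SignType.sign x = SignType.sign y := by
  rw [← h, sign_mul, sign_pos hk, one_mul]

theorem TrisectorFrame.shadowType_eq {Si Sj Sk Sa : Site} (T : TrisectorFrame Si Sj Sk)
    (h : ShadowInput Si Sj Sk Sa) : T.shadowType Sa =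
      typeOfForms fun n => SignType.sign (shadowForm (inputQuantities Si Sj Sk Sa) n) := by
  have hG := T.normalSq_pos
  have hs := T.scale_pos
  have hH := T.height_pos
  have hW := T.gramDet_pos
  have hp := T.normalSq_mul_wp Sa
  have hm := T.normalSq_mul_wm Sa
  have hpm := T.wp_mul_wm Sa
  have h1 := sign_eq_of_add_of_sub_of_mul (T.coefPlus_ne_zero h) (T.coefMinus_ne_zero h)
    (m := meanForm (inputQuantities Si Sj Sk Sa)) (d := tripleForm (inputQuantities Si Sj Sk Sa))
    (p := gramDetForm (inputQuantities Si Sj Sk Sa))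
    (sign_eq_of_mul_eq (k := normalSq Si Sj Sk / T.scale) (by positivity) (by
      rw [coefPlus, coefMinus]
      field_simp
      linear_combination hp + hm))
    (sign_eq_of_mul_eq (k := normalSq Si Sj Sk / (T.scale * T.height)) (by positivity) (by
      rw [coefPlus, coefMinus]
      field_simp
      linear_combination hp - hm))
    (by
      rw [← Left.sign_neg]
      refine sign_eq_of_mul_eq (k := normalSq Si Sj Sk * 4 / T.scale ^ 2) (by positivity) ?_
      rw [coefPlus, coefMinus]
      field_simp
      linear_combination 4 * hpm)
  have h2 := sign_eq_of_mul_eq (by positivity) (T.coefZero_eq Sa)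
  have h3 := sign_eq_of_mul_eq (by positivity) (T.discrim_eq Sa)
  rw [shadowType, h1.1, h1.2, h2, h3]
  rfl

end Apollonius

theorem mainTheorem7 :
    -- the point `o`, the map `ζ` and the planes `Π⁻`, `Π⁺` are what they should be
    (∀ Si Sj Sk : Apollonius.Site, Apollonius.HyperbolicTriple Si Sj Sk →
      Apollonius.trisector Si Sj Sk ∩
          (affineSpan ℝ {Si.center, Sj.center, Sk.center} : Set Apollonius.E3) =
        {Apollonius.trisectorOrigin Si Sj Sk} ∧
      Set.BijOn (Apollonius.zeta Si Sj Sk) (Apollonius.trisector Si Sj Sk) Set.univ ∧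
      Apollonius.planeMinus Si Sj Sk ≠ Apollonius.planePlus Si Sj Sk ∧
      Apollonius.commonTangentPlanes Si Sj Sk =
        {Apollonius.planeMinus Si Sj Sk, Apollonius.planePlus Si Sj Sk} ∧
      Apollonius.IsPlaneAtInfinity Si Sj Sk Filter.atBot (Apollonius.planeMinus Si Sj Sk) ∧
      Apollonius.IsPlaneAtInfinity Si Sj Sk Filter.atTop (Apollonius.planePlus Si Sj Sk)) ∧
    (∀ Si Sj Sk Sa : Apollonius.Site, Apollonius.ShadowInput Si Sj Sk Sa →
      -- the shadow region has exactly one of the six types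
      (∃! t, Apollonius.HasShadowType (Apollonius.shadowImage Si Sj Sk Sa) t) ∧
      -- the type is determined by the Existence and Distance predicates
      (∀ t, Apollonius.HasShadowType (Apollonius.shadowImage Si Sj Sk Sa) t ↔
        Apollonius.ShadowTable (Apollonius.existencePred Si Sj Sk Sa)
          (Apollonius.distancePred Si Sj Sk Sa) t) ∧
      -- the endpoint `φ` is `v_ijka`, and the endpoint `χ` is `v_ikja`
      (∀ φ, Apollonius.shadowImage Si Sj Sk Sa = Set.Iio φ →
        ∃ v, Apollonius.verticesPos Si Sj Sk Sa = {v} ∧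
          Apollonius.verticesNeg Si Sj Sk Sa = ∅ ∧ Apollonius.zeta Si Sj Sk v = φ) ∧
      (∀ χ, Apollonius.shadowImage Si Sj Sk Sa = Set.Ioi χ →
        ∃ w, Apollonius.verticesNeg Si Sj Sk Sa = {w} ∧
          Apollonius.verticesPos Si Sj Sk Sa = ∅ ∧ Apollonius.zeta Si Sj Sk w = χ) ∧
      (∀ χ φ, χ < φ → Apollonius.shadowImage Si Sj Sk Sa = Set.Ioo χ φ →
        ∃ w v, Apollonius.verticesNeg Si Sj Sk Sa = {w} ∧
          Apollonius.verticesPos Si Sj Sk Sa = {v} ∧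
          Apollonius.zeta Si Sj Sk w = χ ∧ Apollonius.zeta Si Sj Sk v = φ) ∧
      (∀ φ χ, φ < χ → Apollonius.shadowImage Si Sj Sk Sa = Set.Iio φ ∪ Set.Ioi χ →
        ∃ w v, Apollonius.verticesNeg Si Sj Sk Sa = {w} ∧
          Apollonius.verticesPos Si Sj Sk Sa = {v} ∧
          Apollonius.zeta Si Sj Sk w = χ ∧ Apollonius.zeta Si Sj Sk v = φ)) ∧
    -- the type can be read off the signs of finitely many polynomials of degree at most 8 in the
    -- input quantities, the same ones for all inputs
    (∃ (N : ℕ) (P : Fin N → MvPolynomial (Fin 4 × Fin 4) ℤ)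
        (F : (Fin N → SignType) → Apollonius.ShadowType),
      (∀ n, (P n).totalDegree ≤ 8) ∧
      ∀ Si Sj Sk Sa : Apollonius.Site, Apollonius.ShadowInput Si Sj Sk Sa →
        Apollonius.HasShadowType (Apollonius.shadowImage Si Sj Sk Sa)
          (F fun n => SignType.sign
            (MvPolynomial.aeval (Apollonius.inputQuantities Si Sj Sk Sa) (P n)))) := by
  refine ⟨fun Si Sj Sk h => ?_, fun Si Sj Sk Sa h => ?_, 5, Apollonius.shadowPolynomial,
    Apollonius.typeOfForms, Apollonius.totalDegree_shadowPolynomial_le, fun Si Sj Sk Sa h => ?_⟩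
  · obtain ⟨T⟩ := h.nonempty_frame
    refine ⟨?_, T.bijOn_zeta, T.planeMinus_ne_planePlus, T.commonTangentPlanes_eq, ?_, ?_⟩
    · rw [T.trisectorOrigin_eq, T.trisector_inter_affineSpan]
    · rw [T.planeMinus_eq]
      exact T.isPlaneAtInfinity_atBot
    · rw [T.planePlus_eq]
      exact T.isPlaneAtInfinity_atTop
  · obtain ⟨T⟩ := h.triple.nonempty_frame
    refine ⟨⟨_, T.hasShadowType_shadowImage h, fun t => (T.hasShadowType_iff h t).1⟩, fun t => ?_,
      fun φ => T.vertices_of_shadowImage_eq_Iio h, fun χ => T.vertices_of_shadowImage_eq_Ioi h,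
      fun χ φ => T.vertices_of_shadowImage_eq_Ioo h,
      fun φ χ => T.vertices_of_shadowImage_eq_union h⟩
    rw [T.hasShadowType_iff h]
    constructor
    · rintro rfl
      exact T.shadowTable h
    · exact fun ht => ht.unique (T.shadowTable h)
  · obtain ⟨T⟩ := h.triple.nonempty_frame
    simp only [Apollonius.aeval_shadowPolynomial]
    rw [← T.shadowType_eq h]
    exact T.hasShadowType_shadowImage h
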